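/- **Conventions.** Identify $\mathrm{SU}(2)$ with the unit quaternions, so that the trace is twice the real part. Let the braid group $B_n$ act on the free group on $x_1,\dots,x_n$ from the right by $x_i\sigma_i=x_ix_{i+1}x_i^{-1}$, $x_{i+1}\sigma_i=x_i$, $x_j\sigma_i=x_j$ for $j\ne i,i+1$, and hence on tuples $X=(X_1,\dots,X_n)\in \mathrm{SU}(2)^n$, with $X\beta=(X_1\beta,\dots,X_n\beta)$. Let $c\in\{1,\dots,\mu\}^n$ be a coloring of the strands, $\beta\in B_n$ a braid preserving $c$, and $\alpha\in(0,\pi)^\mu$. Put $$R=\{X\in \mathrm{SU}(2)^n:\ \operatorname{tr}X_i=2\cos\alpha_{c_i}\},\qquad H=\{(X,Y)\in R\times R:\ X_1\cdots X_n=Y_1\cdots Y_n\},$$ $\Lambda=\{(X,X)\}\subset H$ and $\Gamma_\beta=\{(X,X\beta)\}\subset H$. Denote by $\widehat H,\widehat\Lambda,\widehat\Gamma_\beta$ the quotients by conjugation of the irreducible (non-commuting) tuples in these spaces. They are manifolds of dimensions $4n-6$, $2n-3$, $2n-3$. Orient the conjugacy classes of trace $2\cos\theta$, $0<\theta<\pi$,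 as $2$-spheres in a fixed way; $R$ by the product orientation; $\Lambda$ and $\Gamma_\beta$ through the projection to the first $n$ coordinates; $H$ as the preimage of $1$ under $(X,Y)\mapsto X_1\cdots X_n(Y_1\cdots Y_n)^{-1}$; and the quotients by the base–fiber rule. The Bénard–Conway invariant $h_L(\alpha)$ of the colored link $L$ that is the closure of $\beta$ is the intersection number $\langle\widehat\Lambda,\widehat\Gamma_\beta\rangle_{\widehat H}$. It is defined if the multivariable Alexander polynomial $\Delta_L$ (the greatest common divisor of the minors of order $n-1$ of the Fox matrix of $\langle x_1,\dots,x_n\mid x_i\beta=x_i\rangle$, with $x_i\mapsto t_{c_i}$) has no zero among the points $(e^{\pm2\mathrm i\alpha_1},\dots,e^{\pm2\mathrm i\alpha_\mu})$; the intersection is then compact. The intersection number is the signed count of the intersection points if the intersection is transverse, and the signed count after a compactly supported perturbation of $\widehat\Gamma_\beta$ making it transverse otherwise. For an integer $\ell\neq0$ let $L_\ell$ be the $(2,2\ell)$-torus link, given as the closure of the braid $\sigma_1^{2\ell}\in B_2$ with the coloring $c=(1,2)$ (right-handed for $\ell>0$, left-handed for $\ell<0$). **Corollary.** Let $\ell>0$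 be an integer and let $(\alpha_1,\alpha_2)\in(0,\pi)^2$ be such that $$\alpha_1+\alpha_2\ne\frac{\pi m}{\ell}\quad\text{and}\quad \alpha_1-\alpha_2+\pi\neq\frac{\pi m}{\ell}\qquad\text{for all integers } m \text{ with } 0<m<\ell \text{ or } \ell<m<2\ell .$$ Then, computed from the braids $\sigma_1^{2\ell}$ and $\sigma_1^{-2\ell}$, the invariants $h_{L_\ell}(\alpha)$ and $h_{L_{-\ell}}(\alpha)$ are well defined: the Alexander polynomial does not vanish at the points $(e^{\pm2\mathrm i\alpha_1},e^{\pm2\mathrm i\alpha_2})$, the intersection $\widehat\Lambda\cap\widehat\Gamma_\beta$ is compact, and there is exactly one intersection number in the above sense. Moreover $$h_{L_{-\ell}}(\alpha)=-h_{L_\ell}(\alpha).$$ -/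

import Mathlib

open scoped Quaternion

noncomputable section

namespace BenardConway

/-! ## Braid groups and their action on free groups -/

/-- The lower strand `i` on which the generator `σ_i` acts (strands are numbered from `0`). -/
def lo {n : ℕ} (i : Fin (n - 1)) : Fin n := ⟨i, by omega⟩

/-- The strand `i + 1` on which the generator `σ_i` acts. -/
def hi {n : ℕ} (i : Fin (n - 1)) : Fin n := ⟨i + 1, by omega⟩

/-- The Artin relations `σ_i σ_{i+1} σ_i = σ_{i+1} σ_i σ_{i+1}` and `σ_i σ_j = σ_j σ_i`
for `|i - j| > 1`. -/
def braidRels (n : ℕ) : Set (FreeGroup (Fin (n - 1))) :=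
  {r | ∃ i j : Fin (n - 1), (j : ℕ) = i + 1 ∧
    r = (FreeGroup.of i * FreeGroup.of j * FreeGroup.of i) *
      (FreeGroup.of j * FreeGroup.of i * FreeGroup.of j)⁻¹} ∪
  {r | ∃ i j : Fin (n - 1), (i : ℕ) + 1 < j ∧
    r = (FreeGroup.of i * FreeGroup.of j) * (FreeGroup.of j * FreeGroup.of i)⁻¹}

/-- The Artin braid group `B_n`. -/
abbrev BraidGroup (n : ℕ) : Type := PresentedGroup (braidRels n)

/-- The endomorphism `x ↦ x σ_i` of the free group: `x_i ↦ x_i x_{i+1} x_i⁻¹`, `x_{i+1} ↦ x_i`,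
and `x_j ↦ x_j` otherwise. -/
def sigmaHom {n : ℕ} (i : Fin (n - 1)) : FreeGroup (Fin n) →* FreeGroup (Fin n) :=
  FreeGroup.lift fun j =>
    if j = lo i then FreeGroup.of (lo i) * FreeGroup.of (hi i) * (FreeGroup.of (lo i))⁻¹
    else if j = hi i then FreeGroup.of (lo i)
    else FreeGroup.of j

/-- The inverse of `sigmaHom i`. -/
def sigmaInvHom {n : ℕ} (i : Fin (n - 1)) : FreeGroup (Fin n) →* FreeGroup (Fin n) :=
  FreeGroup.lift fun j =>
    if j = lo i then FreeGroup.of (hi i)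
    else if j = hi i then (FreeGroup.of (hi i))⁻¹ * FreeGroup.of (lo i) * FreeGroup.of (hi i)
    else FreeGroup.of j

theorem hi_ne_lo {n : ℕ} (i : Fin (n - 1)) : hi i ≠ lo i := by
  simp [hi, lo, Fin.ext_iff]

/-- The automorphism `x ↦ x σ_i` of the free group on `x_0, …, x_{n-1}`. -/
def sigmaAut {n : ℕ} (i : Fin (n - 1)) : MulAut (FreeGroup (Fin n)) :=
  MonoidHom.toMulEquiv (sigmaHom i) (sigmaInvHom i)
    (by
      ext j
      by_cases h1 : j = lo i
      · subst h1; simp [sigmaHom, sigmaInvHom, hi_ne_lo, mul_assoc]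
      · by_cases h2 : j = hi i
        · subst h2; simp [sigmaHom, sigmaInvHom, hi_ne_lo]
        · simp [sigmaHom, sigmaInvHom, h1, h2])
    (by
      ext j
      by_cases h1 : j = lo i
      · subst h1; simp [sigmaHom, sigmaInvHom, hi_ne_lo]
      · by_cases h2 : j = hi i
        · subst h2; simp [sigmaHom, sigmaInvHom, hi_ne_lo, mul_assoc]
        · simp [sigmaHom, sigmaInvHom, h1, h2])

theorem sigmaAut_of {n : ℕ} (i : Fin (n - 1)) (j : Fin n) :
    sigmaAut i (FreeGroup.of j) =
      if j = lo i then FreeGroup.of (lo i) * FreeGroup.of (hi i) * (FreeGroup.of (lo i))⁻¹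
      else if j = hi i then FreeGroup.of (lo i)
      else FreeGroup.of j := by
  simp [sigmaAut, sigmaHom]

theorem mulAut_ext {n : ℕ} {f g : MulAut (FreeGroup (Fin n))}
    (h : ∀ j, f (FreeGroup.of j) = g (FreeGroup.of j)) : f = g := by
  have : f.toMonoidHom = g.toMonoidHom := by
    ext j
    exact h j
  exact MulEquiv.ext fun x => DFunLike.congr_fun this x

theorem sigmaAut_braid {n : ℕ} (i j : Fin (n - 1)) (h : (j : ℕ) = i + 1) :
    sigmaAut i * sigmaAut j * sigmaAut i = sigmaAut j * sigmaAut i * sigmaAut j := by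
  have e : lo j = hi i := by simp [lo, hi, h]
  have h1 : hi i ≠ lo i := hi_ne_lo i
  have h2 : hi j ≠ hi i := by simp [hi, Fin.ext_iff, h]
  have h3 : hi j ≠ lo i := by simp [hi, lo, Fin.ext_iff, h]; omega
  apply mulAut_ext
  intro k
  by_cases k1 : k = lo i
  · subst k1
    simp [sigmaAut_of, e, h1, h2, h3, h1.symm, h2.symm, h3.symm, mul_assoc]
  by_cases k2 : k = hi i
  · subst k2
    simp [sigmaAut_of, e, h1, h2, h3, h1.symm, h2.symm, h3.symm, mul_assoc]
  by_cases k3 : k = hi j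
  · subst k3
    simp [sigmaAut_of, e, h1, h2, h3, h1.symm, h2.symm, h3.symm, mul_assoc]
  simp [sigmaAut_of, e, k1, k2, k3]

theorem sigmaAut_comm {n : ℕ} (i j : Fin (n - 1)) (h : (i : ℕ) + 1 < j) :
    sigmaAut i * sigmaAut j = sigmaAut j * sigmaAut i := by
  have h1 : hi i ≠ lo i := hi_ne_lo i
  have h2 : hi j ≠ lo j := hi_ne_lo j
  have h3 : lo j ≠ lo i := by simp [lo, Fin.ext_iff]; omega
  have h4 : lo j ≠ hi i := by simp [lo, hi, Fin.ext_iff]; omega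
  have h5 : hi j ≠ lo i := by simp [lo, hi, Fin.ext_iff]; omega
  have h6 : hi j ≠ hi i := by simp [hi, Fin.ext_iff]; omega
  apply mulAut_ext
  intro k
  by_cases k1 : k = lo i
  · subst k1
    simp [sigmaAut_of, h1, h2, h3.symm, h4.symm, h5.symm, h6.symm]
  by_cases k2 : k = hi i
  · subst k2
    simp [sigmaAut_of, h1, h2, h3.symm, h4.symm, h5.symm, h6.symm]
  by_cases k3 : k = lo j
  · subst k3
    simp [sigmaAut_of, h1, h2, h3, h4, h5, h6]
  by_cases k4 : k = hi j
  · subst k4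
    simp [sigmaAut_of, h1, h2, h3, h4, h5, h6]
  simp [sigmaAut_of, k1, k2, k3, k4]

/-- The right action of `B_n` on the free group, `x (β γ) = (x β) γ`, as a homomorphism to the
opposite of the automorphism group. -/
def artin (n : ℕ) : BraidGroup n →* (MulAut (FreeGroup (Fin n)))ᵐᵒᵖ :=
  PresentedGroup.toGroup (rels := braidRels n)
    (f := fun i => MulOpposite.op (sigmaAut i)) (by
      rintro r (⟨i, j, h, rfl⟩ | ⟨i, j, h, rfl⟩)
      · have := sigmaAut_braid i j h
        simp only [map_mul, map_inv, FreeGroup.lift_apply_of, ← MulOpposite.op_mul]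
        rw [mul_inv_eq_one, ← mul_assoc, ← mul_assoc, this]
      · have := sigmaAut_comm i j h
        simp only [map_mul, map_inv, FreeGroup.lift_apply_of, ← MulOpposite.op_mul]
        rw [mul_inv_eq_one, this])

/-- The element `w β` of the free group, for a braid `β`. -/
def freeAct {n : ℕ} (w : FreeGroup (Fin n)) (β : BraidGroup n) : FreeGroup (Fin n) :=
  (artin n β).unop w

/-- The permutation of the strands underlying a braid. -/
def braidPerm (n : ℕ) : BraidGroup n →* Equiv.Perm (Fin n) :=
  PresentedGroup.toGroup (rels := braidRels n)
    (f := fun i => Equiv.swap (lo i) (hi i)) (by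
      rintro r (⟨i, j, h, rfl⟩ | ⟨i, j, h, rfl⟩)
      · have e : lo j = hi i := by simp [lo, hi, h]
        have h1 : hi i ≠ lo i := hi_ne_lo i
        have h2 : hi j ≠ hi i := by simp [hi, Fin.ext_iff, h]
        have h3 : hi j ≠ lo i := by simp [hi, lo, Fin.ext_iff, h]; omega
        simp only [map_mul, map_inv, FreeGroup.lift_apply_of]
        rw [mul_inv_eq_one, e]
        ext k
        simp only [Equiv.Perm.mul_apply, Equiv.swap_apply_def]
        grind
      · have h3 : lo j ≠ lo i := by simp [lo, Fin.ext_iff]; omega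
        have h4 : lo j ≠ hi i := by simp [lo, hi, Fin.ext_iff]; omega
        have h5 : hi j ≠ lo i := by simp [lo, hi, Fin.ext_iff]; omega
        have h6 : hi j ≠ hi i := by simp [hi, Fin.ext_iff]; omega
        simp only [map_mul, map_inv, FreeGroup.lift_apply_of]
        rw [mul_inv_eq_one]
        exact (Equiv.Perm.disjoint_swap_swap
          (by simp [h3.symm, h4.symm, h5.symm, h6.symm, (hi_ne_lo i).symm,
            (hi_ne_lo j).symm])).commute.eq)

/-- The colored braid group `B_c ⊆ B_n`: the braids that carry the coloring `c` of the endpoints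
to itself. -/
def coloredBraidGroup {n μ : ℕ} (c : Fin n → Fin μ) : Subgroup (BraidGroup n) where
  carrier := {β | ∀ j, c (braidPerm n β j) = c j}
  one_mem' := by simp
  mul_mem' := by
    intro a b ha hb j
    rw [map_mul, Equiv.Perm.mul_apply]
    exact (ha _).trans (hb j)
  inv_mem' := by
    intro a ha j
    have := ha ((braidPerm n a)⁻¹ j)
    simpa using this.symm

/-! ## Tuples of unit quaternions -/

/-- The group `SU(2)` is identified with the unit quaternions; the trace of a unit quaternion `q`
is `2 * q.re`. `repSpace θ` is the set of tuples of elements of `SU(2)` whose `i`-th entry has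
trace `2 cos (θ i)`. With `θ i = α (c i)` it is `R_n^{α,c}`. -/
def repSpace {N : ℕ} (θ : Fin N → ℝ) : Set (Fin N → ℍ[ℝ]) :=
  {X | ∀ i, ‖X i‖ = 1 ∧ 2 * (X i).re = 2 * Real.cos (θ i)}

/-- A tuple in `SU(2)`, seen as a representation of a free group, is irreducible exactly if its
entries do not all commute. -/
def IsIrreducible {N : ℕ} (X : Fin N → ℍ[ℝ]) : Prop :=
  ∃ i j, X i * X j ≠ X j * X i

/-- The irreducible part of `repSpace θ`. -/
def irrRep {N : ℕ} (θ : Fin N → ℝ) : Set (Fin N → ℍ[ℝ]) :=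
  {X | X ∈ repSpace θ ∧ IsIrreducible X}

/-- Simultaneous conjugation of a tuple. -/
def conjTuple {N : ℕ} (g : ℍ[ℝ]) (X : Fin N → ℍ[ℝ]) : Fin N → ℍ[ℝ] :=
  fun i => g * X i * g⁻¹

/-- The product `X_1 ⋯ X_n` of the first half of a tuple `(X_1, …, X_n, Y_1, …, Y_n)`. -/
def firstProd {n : ℕ} (P : Fin (n + n) → ℍ[ℝ]) : ℍ[ℝ] :=
  (List.ofFn fun i : Fin n => P (Fin.castAdd n i)).prod

/-- The product `Y_1 ⋯ Y_n` of the second half of a tuple `(X_1, …, X_n, Y_1, …, Y_n)`. -/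
def secondProd {n : ℕ} (P : Fin (n + n) → ℍ[ℝ]) : ℍ[ℝ] :=
  (List.ofFn fun i : Fin n => P (Fin.natAdd n i)).prod

/-- The map `f_n (X, Y) = X_1 ⋯ X_n (Y_1 ⋯ Y_n)⁻¹`. -/
def defect {n : ℕ} (P : Fin (n + n) → ℍ[ℝ]) : ℍ[ℝ] :=
  firstProd P * (secondProd P)⁻¹

/-- The irreducible part of the ambient space `H_n^{α,c}` of all `(X, Y)` in
`R_n^{α,c} × R_n^{α,c}` with `X_1 ⋯ X_n = Y_1 ⋯ Y_n`. -/
def irrAmbient {n : ℕ} (θ : Fin n → ℝ) : Set (Fin (n + n) → ℍ[ℝ]) :=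
  {P | P ∈ irrRep (Fin.append θ θ) ∧ firstProd P = secondProd P}

/-- The point `(Z, Z)` of the diagonal. -/
def diag {n : ℕ} (Z : Fin n → ℍ[ℝ]) : Fin (n + n) → ℍ[ℝ] := Fin.append Z Z

open Classical in
/-- A quaternion as a unit of the quaternion algebra (with the value `1` at `0`). -/
def toUnit (q : ℍ[ℝ]) : ℍ[ℝ]ˣ := if h : q ≠ 0 then Units.mk0 q h else 1

/-- The value of a word at a tuple of non-zero quaternions. -/
def evalWord {n : ℕ} (X : Fin n → ℍ[ℝ]) (w : FreeGroup (Fin n)) : ℍ[ℝ] :=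
  (FreeGroup.lift (fun i => toUnit (X i)) w : ℍ[ℝ]ˣ)

/-- The tuple `X β = (X_1 β, …, X_n β)`. -/
def tupleAct {n : ℕ} (X : Fin n → ℍ[ℝ]) (β : BraidGroup n) : Fin n → ℍ[ℝ] :=
  fun j => evalWord X (freeAct (FreeGroup.of j) β)

/-- The parametrization `X ↦ (X, X β)` of the graph `Γ_β`. -/
def graphMap {n : ℕ} (β : BraidGroup n) (X : Fin n → ℍ[ℝ]) : Fin (n + n) → ℍ[ℝ] :=
  Fin.append X (tupleAct X β)

/-! ## Tangent spaces and orientations -/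

/-- The tangent space of `repSpace θ` at `X`, where each factor of `repSpace θ` is the `2`-sphere
of unit quaternions with a fixed real part. -/
def tangent {N : ℕ} (X : Fin N → ℍ[ℝ]) : Set (Fin N → ℍ[ℝ]) :=
  {ξ | ∀ i, (ξ i).re = 0 ∧ inner ℝ (X i) (ξ i) = 0}

/-- The determinant of the imaginary parts of three quaternions with respect to `i, j, k`. -/
def triple (x u v : ℍ[ℝ]) : ℝ :=
  Matrix.det !![x.imI, x.imJ, x.imK; u.imI, u.imJ, u.imK; v.imI, v.imJ, v.imK]

/-- `(u, v)` is a positive frame of the conjugacy class of `x`, a `2`-sphere centered at a real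
number: `u` and `v` are tangent to it at `x`, and followed by them the outward normal gives a
positive frame of the space of imaginary quaternions. -/
def IsPositivePair (x u v : ℍ[ℝ]) : Prop :=
  u.re = 0 ∧ v.re = 0 ∧ inner ℝ x u = 0 ∧ inner ℝ x v = 0 ∧ 0 < triple x u v

/-- The frame of the product of spheres given by a frame of each factor. -/
def productFrame {N : ℕ} (u v : Fin N → ℍ[ℝ]) (p : Fin N × Fin 2) : Fin N → ℍ[ℝ] :=
  Pi.single p.1 (if p.2 = 0 then u p.1 else v p.1)

/-- The vectors `e_0, e_1, …`, in this order, form a basis of the tangent space `tangent X` that is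
positive (`s = 1`) or negative (`s = -1`) for the product orientation: they are obtained from the
product of positive frames of the factors by a matrix whose determinant has the sign `s`. -/
def IsFrame {N : ℕ} (X : Fin N → ℍ[ℝ]) (e : Fin (N * 2) → Fin N → ℍ[ℝ]) (s : ℤ) : Prop :=
  ∃ u v : Fin N → ℍ[ℝ], (∀ i, IsPositivePair (X i) (u i) (v i)) ∧
    ∃ A : Matrix (Fin N × Fin 2) (Fin N × Fin 2) ℝ, 0 < (s : ℝ) * A.det ∧
      ∀ p, e (finProdFinEquiv p) = ∑ q, A p q • productFrame u v q

/-- The tangent vectors at `X` to its orbit under conjugation, in the directions of the basis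
`i, j, k` of the Lie algebra of `SU(2)`. -/
def orbitFrame {N : ℕ} (X : Fin N → ℍ[ℝ]) (k : Fin 3) : Fin N → ℍ[ℝ] :=
  let ξ : ℍ[ℝ] := ![⟨0, 1, 0, 0⟩, ⟨0, 0, 1, 0⟩, ⟨0, 0, 0, 1⟩] k
  fun i => ξ * X i - X i * ξ

/-! ## Intersection numbers

Submanifolds of the quotient of the irreducible part of `H_n^{α,c}` by conjugation are handled
through their preimages. The map `G` is the parametrization `X ↦ (X, X β)` of the graph or an
equivariant perturbation of it. -/

/-- The irreducible tuples `X` for which `G X` lies on the diagonal. -/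
def meets {n : ℕ} (θ : Fin n → ℝ) (G : (Fin n → ℍ[ℝ]) → Fin (n + n) → ℍ[ℝ]) :
    Set (Fin n → ℍ[ℝ]) :=
  {X | X ∈ irrRep θ ∧ ∃ Z, G X = diag Z}

theorem conjTuple_one {N : ℕ} (X : Fin N → ℍ[ℝ]) : conjTuple 1 X = X := by
  funext i
  simp [conjTuple]

theorem conjTuple_conjTuple {N : ℕ} (g h : ℍ[ℝ]) (X : Fin N → ℍ[ℝ]) :
    conjTuple g (conjTuple h X) = conjTuple (g * h) X := by
  funext i
  simp [conjTuple, mul_assoc]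

/-- Conjugacy by an element of `SU(2)`. -/
def conjSetoid {N : ℕ} (S : Set (Fin N → ℍ[ℝ])) : Setoid S where
  r X Y := ∃ g : ℍ[ℝ], ‖g‖ = 1 ∧ (Y : Fin N → ℍ[ℝ]) = conjTuple g X
  iseqv :=
    { refl := fun X => ⟨1, by simp, (conjTuple_one _).symm⟩
      symm := by
        rintro X Y ⟨g, hg, h⟩
        have h0 : g ≠ 0 := by
          rintro rfl
          simp at hg
        refine ⟨g⁻¹, by simp [hg], ?_⟩
        rw [h, conjTuple_conjTuple, inv_mul_cancel₀ h0, conjTuple_one]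
      trans := by
        rintro X Y Z ⟨g, hg, h⟩ ⟨g', hg', h'⟩
        exact ⟨g' * g, by simp [hg, hg'], by rw [h', h, conjTuple_conjTuple]⟩ }

/-- The intersection points, as conjugacy classes, with the quotient topology. -/
abbrev IntersectionPoints {n : ℕ} (θ : Fin n → ℝ)
    (G : (Fin n → ℍ[ℝ]) → Fin (n + n) → ℍ[ℝ]) : Type :=
  Quotient (conjSetoid (meets θ G))

/-- The diagonal and the image of `G` are transverse in the irreducible part of `H_n^{α,c}`: at every
intersection point `(Z, Z) = G X`, the tangent space of `H_n^{α,c}`, which is the kernel of the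
derivative of `defect` on the tangent space of `R_n^{α,c} × R_n^{α,c}`, is the sum of the tangent
spaces of the two. All of them contain the directions of the orbit, so that this is transversality
in the quotient by conjugation. -/
def IsTransverse {n : ℕ} (θ : Fin n → ℝ) (G : (Fin n → ℍ[ℝ]) → Fin (n + n) → ℍ[ℝ]) : Prop :=
  ∀ X ∈ irrRep θ, ∀ Z, G X = diag Z →
    ∀ τ ∈ tangent (diag Z), fderiv ℝ defect (diag Z) τ = 0 →
      ∃ a ∈ tangent Z, ∃ b ∈ tangent X, τ = diag a + fderiv ℝ G X b

/-- The local intersection number, in the quotient by conjugation, of the diagonal with the image of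
`G` at the point `(Z, Z) = G X` is `s`. All orientations follow the base-fiber rule:
* `a` gives a positive frame of the quotient of the diagonal and `b` one of the domain of `G`, since
  the orbit directions complete them to positive frames;
* `w` is a lift of a positive frame of the Lie algebra of `SU(2)`, hence a frame `e` of the kernel of
  the derivative of `defect` is positive if `w` followed by `e` is positive;
* a frame of the quotient of this kernel by the orbit directions is positive if followed by the
  orbit directions it is positive. -/
def HasSign {n : ℕ} (G : (Fin n → ℍ[ℝ]) → Fin (n + n) → ℍ[ℝ]) (X Z : Fin n → ℍ[ℝ])
    (s : ℤ) : Prop :=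
  ∃ (m : ℕ) (hm : m + 3 = n * 2) (w : Fin 3 → Fin (n + n) → ℍ[ℝ]) (a b : Fin m → Fin n → ℍ[ℝ]),
    IsFrame Z (Fin.append a (orbitFrame Z) ∘ Fin.cast hm.symm) 1 ∧
    IsFrame X (Fin.append b (orbitFrame X) ∘ Fin.cast hm.symm) 1 ∧
    0 < triple (fderiv ℝ defect (diag Z) (w 0)) (fderiv ℝ defect (diag Z) (w 1))
      (fderiv ℝ defect (diag Z) (w 2)) ∧
    IsFrame (diag Z)
      (Fin.append
        (Fin.append (Fin.append w fun i => diag (a i)) fun i => fderiv ℝ G X (b i))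
        (orbitFrame (diag Z)) ∘
          Fin.cast (show (n + n) * 2 = 3 + m + m + 3 by omega)) s

open Classical in
/-- The sign `1` or `-1` with which `X` contributes to the intersection number. -/
def localSign {n : ℕ} (G : (Fin n → ℍ[ℝ]) → Fin (n + n) → ℍ[ℝ]) (X : Fin n → ℍ[ℝ]) : ℤ :=
  (if ∃ Z, G X = diag Z ∧ HasSign G X Z 1 then 1 else 0) -
    (if ∃ Z, G X = diag Z ∧ HasSign G X Z (-1) then 1 else 0)

/-- The number of intersection points, counted with signs. -/
def signedCount {n : ℕ} (θ : Fin n → ℝ) (G : (Fin n → ℍ[ℝ]) → Fin (n + n) → ℍ[ℝ]) : ℤ :=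
  ∑ᶠ q : IntersectionPoints θ G, localSign G (q.out : Fin n → ℍ[ℝ])

/-- `G` is a smooth perturbation with compact support of the map `X ↦ (X, X β)` on conjugacy
classes of irreducible tuples. -/
structure IsPerturbation {n : ℕ} (θ : Fin n → ℝ) (β : BraidGroup n)
    (G : (Fin n → ℍ[ℝ]) → Fin (n + n) → ℍ[ℝ]) : Prop where
  smooth : ∃ U, IsOpen U ∧ irrRep θ ⊆ U ∧ ContDiffOn ℝ (⊤ : ℕ∞) G U
  homotopy : ∃ (F : ℝ → (Fin n → ℍ[ℝ]) → Fin (n + n) → ℍ[ℝ]) (K : Set (Fin n → ℍ[ℝ])),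
    ContinuousOn (fun q : ℝ × (Fin n → ℍ[ℝ]) => F q.1 q.2) (Set.Icc 0 1 ×ˢ irrRep θ) ∧
    (∀ t ∈ Set.Icc (0 : ℝ) 1, ∀ X ∈ irrRep θ, F t X ∈ irrAmbient θ ∧
      ∀ g : ℍ[ℝ], ‖g‖ = 1 → F t (conjTuple g X) = conjTuple g (F t X)) ∧
    (∀ X ∈ irrRep θ, F 0 X = graphMap β X ∧ F 1 X = G X) ∧
    IsCompact K ∧ K ⊆ irrRep θ ∧
    ∀ t ∈ Set.Icc (0 : ℝ) 1, ∀ X ∈ irrRep θ, X ∉ K → F t X = graphMap β X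

/-- `k` is the intersection number of the diagonal with the graph of `β` in the quotient by
conjugation: the signed count of the intersection points, after a perturbation of the graph if the
intersection is not transverse. -/
def IsIntersectionNumber {n : ℕ} (θ : Fin n → ℝ) (β : BraidGroup n) (k : ℤ) : Prop :=
  (IsTransverse θ (graphMap β) ∧ k = signedCount θ (graphMap β)) ∨
  (¬ IsTransverse θ (graphMap β) ∧
    ∃ G, IsPerturbation θ β G ∧ IsTransverse θ G ∧ k = signedCount θ G)

/-! ## The multivariable Alexander polynomial -/

/-- The ring of Laurent polynomials `ℤ[t_1^{±1}, …, t_μ^{±1}]`. -/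
abbrev Laurent (μ : ℕ) : Type := AddMonoidAlgebra ℤ (Fin μ → ℤ)

/-- The monomial `t_i ^ k`. -/
def tPow {μ : ℕ} (i : Fin μ) (k : ℤ) : Laurent μ := AddMonoidAlgebra.single (Pi.single i k) 1

theorem tPow_mul {μ : ℕ} (i : Fin μ) (k l : ℤ) : tPow i k * tPow i l = tPow i (k + l) := by
  simp [tPow, AddMonoidAlgebra.single_mul_single, Pi.single_add]

theorem tPow_zero {μ : ℕ} (i : Fin μ) : tPow i 0 = 1 := by
  simp [tPow, AddMonoidAlgebra.one_def]

/-- The matrix with rows `(t_{c i}, ∂x_i/∂x_j)` and `(0, 1)`. -/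
def foxUnit {n μ : ℕ} (c : Fin n → Fin μ) (j i : Fin n) : (Matrix (Fin 2) (Fin 2) (Laurent μ))ˣ where
  val := !![tPow (c i) 1, if i = j then 1 else 0; 0, 1]
  inv := !![tPow (c i) (-1), -(tPow (c i) (-1) * if i = j then 1 else 0); 0, 1]
  val_inv := by
    by_cases h : i = j <;> simp [h, Matrix.one_fin_two, tPow_mul, tPow_zero]
  inv_val := by
    by_cases h : i = j <;> simp [h, Matrix.one_fin_two, tPow_mul, tPow_zero]

/-- The image in `ℤ[t_1^{±1}, …, t_μ^{±1}]`, under `x_i ↦ t_{c i}`, of the Fox derivative `∂w/∂x_j`.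
It satisfies `∂(uv) = ∂u + u ∂v`, being the upper right entry of a product of matrices with rows
`(u, ∂u)` and `(0, 1)`. -/
def foxDeriv {n μ : ℕ} (c : Fin n → Fin μ) (j : Fin n) (w : FreeGroup (Fin n)) : Laurent μ :=
  (FreeGroup.lift (foxUnit c j) w).val 0 1

/-- The Alexander matrix of the presentation `⟨x_1, …, x_n | x_i β = x_i⟩` of the group of the
closure of `β`. -/
def alexanderMatrix {n μ : ℕ} (c : Fin n → Fin μ) (β : BraidGroup n) :
    Matrix (Fin n) (Fin n) (Laurent μ) :=
  Matrix.of fun i j => foxDeriv c j (freeAct (FreeGroup.of i) β * (FreeGroup.of i)⁻¹)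

/-- `Δ` is the multivariable Alexander polynomial of the closure of the colored braid `β`: a greatest
common divisor of the minors of order `n - 1` of the Alexander matrix. It is unique up to units. -/
def IsAlexanderPolynomial {n μ : ℕ} (c : Fin n → Fin μ) (β : BraidGroup n) (Δ : Laurent μ) : Prop :=
  ∀ D : Laurent μ, D ∣ Δ ↔
    ∀ r s : Fin (n - 1) ↪o Fin n, D ∣ ((alexanderMatrix c β).submatrix r s).det

/-- The value of a Laurent polynomial at `ω`. -/
def evalLaurent {μ : ℕ} (ω : Fin μ → ℂ) (p : Laurent μ) : ℂ :=
  p.coeff.sum fun k a => (a : ℂ) * ∏ i, ω i ^ k i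

/-- The Alexander polynomial of the closure of `β` does not vanish at any of the points
`(e^{± 2 i α_1}, …, e^{± 2 i α_μ})`. -/
def AlexanderNonvanishing {n μ : ℕ} (c : Fin n → Fin μ) (β : BraidGroup n) (α : Fin μ → ℝ) : Prop :=
  ∃ Δ, IsAlexanderPolynomial c β Δ ∧
    ∀ ε : Fin μ → ℤˣ,
      evalLaurent (fun i => Complex.exp (((ε i : ℤ) : ℂ) * 2 * Complex.I * (α i : ℂ))) Δ ≠ 0

/-! ## The Bénard–Conway invariant -/

/-- `k` is the Bénard–Conway invariant at `α` of the colored link which is the closure of the colored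
braid `β`: the Alexander polynomial does not vanish on `S(α)`, the intersection of the diagonal with
the graph of `β` is compact, and `k` is their intersection number. -/
structure IsBenardConway {n μ : ℕ} {c : Fin n → Fin μ} (β : coloredBraidGroup c) (α : Fin μ → ℝ)
    (k : ℤ) : Prop where
  alexander : AlexanderNonvanishing c β α
  compact : CompactSpace (IntersectionPoints (fun i => α (c i)) (graphMap (β : BraidGroup n)))
  intersection : IsIntersectionNumber (fun i => α (c i)) (β : BraidGroup n) k

/-- The Bénard–Conway invariant at `α` of the closure of `β` is well defined. -/
def BenardConwayWellDefined {n μ : ℕ} {c : Fin n → Fin μ} (β : coloredBraidGroup c)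
    (α : Fin μ → ℝ) : Prop :=
  ∃! k, IsBenardConway β α k

open Classical in
/-- The Bénard–Conway invariant `h_L(α)` of the closure `L` of the colored braid `β` (with the value
`0` where it is not defined). -/
def benardConway {n μ : ℕ} {c : Fin n → Fin μ} (β : coloredBraidGroup c) (α : Fin μ → ℝ) : ℤ :=
  if h : ∃ k, IsBenardConway β α k then h.choose else 0

/-! ## Torus links -/

/-- The generator `σ_1` of `B_2`. -/
def sigmaOne : BraidGroup 2 := PresentedGroup.of ⟨0, by norm_num⟩

theorem braidPerm_sigmaOne_sq : braidPerm 2 (sigmaOne ^ 2) = 1 := by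
  simp [braidPerm, sigmaOne, pow_two]

/-- The braid `σ_1^{2ℓ}` with the coloring `(1, 2)`, whose closure is the `(2, 2ℓ)`-torus link
`L_ℓ`. -/
def torusBraid (l : ℤ) : coloredBraidGroup (id : Fin 2 → Fin 2) :=
  ⟨sigmaOne ^ (2 * l), by
    intro j
    rw [zpow_mul, map_zpow, show sigmaOne ^ (2 : ℤ) = sigmaOne ^ 2 from rfl,
      braidPerm_sigmaOne_sq]
    simp⟩

/-- The set of `(α_1, α_2)` with `α_1 + α_2 = π m / |ℓ|` or `α_1 - α_2 + π = π m / |ℓ|` for an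
integer `m` with `0 < m < |ℓ|` or `|ℓ| < m < 2 |ℓ|`. -/
def rootSet (l : ℤ) : Set (Fin 2 → ℝ) :=
  {α | ∃ m : ℤ, (0 < m ∧ m < |l| ∨ |l| < m ∧ m < 2 * |l|) ∧
    (α 0 + α 1 = Real.pi * m / |(l : ℝ)| ∨ α 0 - α 1 + Real.pi = Real.pi * m / |(l : ℝ)|)}

end BenardConway

end

open scoped Quaternion

noncomputable section

namespace BenardConway

/-! ## The action of the torus braids -/

/-! The braid `σ_1^{2k}` acts on the free group as conjugation by `p ^ k`, where `p = x_0 x_1`. An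
irreducible pair `X` is therefore an intersection point exactly if `p ^ k` commutes with both
entries. Since `p` itself commutes with neither, De Moivre's formula forces `p ^ l` to be a real
scalar `r` (`sin_eq_zero_of_commute`). The condition is the same for `k` and `-k`, so both braids
have the same intersection points.

At such a point, with `f = p ^ l`, the second component of the derivative of the graph of `σ_1^{2l}`
in a direction `b` is `b j + r⁻¹ [df(b), X j]`, while for `σ_1^{-2l}` it is `b j - r⁻¹ [df(b), X
j]`. The two derivatives add up to `2 (b, b)` (`fderiv_graphMap_torusBraid_add`), hence are opposite
modulo the tangent space of the diagonal. For `n = 2` the quotient of the graph by conjugation has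
dimension `1`, so one vector of the orienting frame changes sign and every local sign is reversed
(`HasSign.neg`).

Both intersections are already transverse, so no perturbation enters and the intersection number is
a plain signed count. A vector of the ambient tangent space is, modulo the diagonal, `(0, d [Im p, X
j])` for a scalar `d` (`exists_eq_smul_commutator`). The graph attains a non-zero multiple of `(0,
[Im p, X j])`, because `Re p` can be varied to first order (`exists_tangent_commutator`).

Compactness holds because `Re p` takes only finitely many values on the intersection
(`meets_torusBraid`). The Alexander polynomial is `1 + T + ⋯ + T ^ (l - 1)` with `T = t_1 t_2`,
whose zeros are the `l`-th roots of unity other than `1`; `rootSet` excludes exactly these. -/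

theorem artin_sigmaOne_sq :
    artin 2 (sigmaOne ^ (2 : ℤ)) =
      MulOpposite.op (MulAut.conj (FreeGroup.of (0 : Fin 2) * FreeGroup.of 1)) := by
  have h : artin 2 sigmaOne = MulOpposite.op (sigmaAut (n := 2) ⟨0, by norm_num⟩) := by
    simp [artin, sigmaOne]
  have hl : lo (n := 2) 0 = 0 := rfl
  have hh : hi (n := 2) 0 = 1 := rfl
  rw [zpow_ofNat, map_pow, h, ← MulOpposite.op_pow]
  congr 1
  apply mulAut_ext
  intro j
  fin_cases j <;> simp [pow_two, sigmaAut_of, hl, hh, mul_assoc]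

theorem freeAct_torusBraid (k : ℤ) (j : Fin 2) :
    freeAct (FreeGroup.of j) (torusBraid k : BraidGroup 2) =
      (FreeGroup.of 0 * FreeGroup.of 1) ^ k * FreeGroup.of j *
        ((FreeGroup.of 0 * FreeGroup.of 1) ^ k)⁻¹ := by
  have h : artin 2 (torusBraid k : BraidGroup 2) =
      MulOpposite.op (MulAut.conj ((FreeGroup.of (0 : Fin 2) * FreeGroup.of 1) ^ k)) := by
    change artin 2 (sigmaOne ^ (2 * k)) = _
    rw [zpow_mul, map_zpow, artin_sigmaOne_sq, ← MulOpposite.op_zpow, ← map_zpow]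
  rw [freeAct, h, MulOpposite.unop_op, MulAut.conj_apply]

theorem coe_toUnit {q : ℍ[ℝ]} (hq : q ≠ 0) : (toUnit q : ℍ[ℝ]) = q := by
  simp [toUnit, hq]

theorem tupleAct_torusBraid (k : ℤ) (X : Fin 2 → ℍ[ℝ]) (hX : ∀ i, X i ≠ 0) (j : Fin 2) :
    tupleAct X (torusBraid k : BraidGroup 2) j =
      (X 0 * X 1) ^ k * X j * ((X 0 * X 1) ^ k)⁻¹ := by
  simp [tupleAct, freeAct_torusBraid, evalWord, coe_toUnit (hX _)]

/-! ## The Alexander polynomial of the torus links -/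

/-- The relators of the closure of `σ_1^{2k}` are the commutators of `(x_0 x_1) ^ k` with the
generators, and Fox derivatives are translation parts of affine maps. Comparing `[V, M] M V` with `V
M` avoids writing out inverses. -/
theorem val_commutator_of_affine {R : Type*} [CommRing R] {V M : (Matrix (Fin 2) (Fin 2) R)ˣ}
    {a b t m : R} (hV : V.val = !![a, b; 0, 1]) (hM : M.val = !![t, m; 0, 1]) :
    (V * M * V⁻¹ * M⁻¹).val = !![1, (1 - t) * b + (a - 1) * m; 0, 1] := by
  have h : !![1, (1 - t) * b + (a - 1) * m; 0, 1] * (M * V).val = (V * M).val := by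
    rw [Units.val_mul, Units.val_mul, hV, hM]
    refine Matrix.ext fun i j => ?_
    fin_cases i <;> fin_cases j <;> simp [Matrix.mul_apply, Fin.sum_univ_two] <;> ring
  have h2 : V * M * V⁻¹ * M⁻¹ = V * M * (M * V)⁻¹ := by group
  rw [h2, Units.val_mul, ← h, mul_assoc, Units.mul_inv, mul_one]

/-- The sum `1 + T + ⋯ + T ^ (l - 1)` with `T = t_1 t_2`. -/
def geomLaurent (l : ℕ) : Laurent 2 := ∑ i ∈ Finset.range l, (tPow 0 1 * tPow 1 1) ^ i

theorem foxUnit_pow (j : Fin 2) (l : ℕ) :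
    ((foxUnit (id : Fin 2 → Fin 2) j 0 * foxUnit id j 1) ^ l).val =
      !![(tPow 0 1 * tPow 1 1) ^ l, geomLaurent l * (if j = 0 then 1 else tPow 0 1); 0, 1] := by
  induction l with
  | zero => simp [geomLaurent, Matrix.one_fin_two]
  | succ l ih =>
    rw [pow_succ, Units.val_mul, ih]
    fin_cases j <;>
    · refine Matrix.ext fun i k => ?_
      fin_cases i <;> fin_cases k <;>
        simp [foxUnit, geomLaurent, Finset.sum_range_succ, Matrix.mul_apply,
          Fin.sum_univ_two] <;> ring

theorem foxUnit_neg_pow (j : Fin 2) (l : ℕ) :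
    ((foxUnit (id : Fin 2 → Fin 2) j 0 * foxUnit id j 1) ^ (-(l : ℤ))).val =
      !![(tPow 0 (-1) * tPow 1 (-1)) ^ l, -(tPow 0 (-1) * tPow 1 (-1)) ^ l *
        geomLaurent l * (if j = 0 then 1 else tPow 0 1); 0, 1] := by
  rw [zpow_neg, zpow_natCast, Units.inv_eq_of_mul_eq_one_left]
  rw [foxUnit_pow]
  have h : ((tPow 0 (-1) * tPow 1 (-1)) * (tPow 0 1 * tPow 1 1) : Laurent 2) = 1 := by
    rw [mul_mul_mul_comm, tPow_mul, tPow_mul]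
    simp [tPow_zero]
  have h' : ((tPow 0 (-1) * tPow 1 (-1)) ^ l * (tPow 0 1 * tPow 1 1) ^ l : Laurent 2) = 1 := by
    rw [← mul_pow, h, one_pow]
  refine Matrix.ext fun i k => ?_
  fin_cases i <;> fin_cases k <;>
    simp [Matrix.mul_apply, Fin.sum_univ_two, -mul_ite, -ite_mul]
  · exact h'
  · ring

theorem geomLaurent_mul (l : ℕ) :
    geomLaurent l * (tPow 0 1 * tPow 1 1 - 1) = (tPow 0 1 * tPow 1 1) ^ l - 1 :=
  geom_sum_mul _ _

theorem alexanderMatrix_apply (k : ℤ) (i j : Fin 2) {a b : Laurent 2}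
    (h : ((foxUnit (id : Fin 2 → Fin 2) j 0 * foxUnit id j 1) ^ k).val = !![a, b; 0, 1]) :
    alexanderMatrix id (torusBraid k : BraidGroup 2) i j =
      (1 - tPow i 1) * b + (a - 1) * (if i = j then 1 else 0) := by
  simp only [alexanderMatrix, Matrix.of_apply, foxDeriv, freeAct_torusBraid, map_mul, map_zpow,
    map_inv, FreeGroup.lift_apply_of]
  rw [val_commutator_of_affine h (M := foxUnit id j i) (t := tPow i 1)
    (m := if i = j then 1 else 0) rfl]
  simp

/-- The substitution `t_1 = 1`. -/
def substOne : Laurent 2 →+* Laurent 2 :=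
  AddMonoidAlgebra.mapDomainRingHom ℤ
    ((AddMonoidHom.single (fun _ : Fin 2 => ℤ) 1).comp (Pi.evalAddMonoidHom (fun _ => ℤ) 1))

theorem substOne_tPow_one (k : ℤ) : substOne (tPow 1 k) = tPow 1 k := by
  simp only [substOne, tPow, AddMonoidAlgebra.mapDomainRingHom_apply,
    AddMonoidAlgebra.mapDomain_single]
  simp

theorem substOne_tPow_zero (k : ℤ) : substOne (tPow 0 k) = 1 := by
  simp only [substOne, tPow, AddMonoidAlgebra.mapDomainRingHom_apply,
    AddMonoidAlgebra.mapDomain_single, AddMonoidAlgebra.one_def]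
  simp

theorem tPow_pow {μ : ℕ} (i : Fin μ) (k : ℕ) : tPow i 1 ^ k = tPow i k := by
  induction k with
  | zero => simp [tPow_zero]
  | succ k ih => rw [pow_succ, ih, tPow_mul]; simp

theorem tPow_sub_one_dvd {μ : ℕ} (i : Fin μ) (k : ℤ) : tPow i 1 - 1 ∣ tPow i k - 1 := by
  have h (n : ℕ) : tPow i 1 - 1 ∣ tPow i (n : ℤ) - 1 := by
    rw [← tPow_pow]
    exact sub_one_dvd_pow_sub_one _ _
  obtain ⟨n, rfl | rfl⟩ := k.eq_nat_or_neg
  · exact h n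
  · have : tPow i (-n : ℤ) - 1 = (tPow i n - 1) * (-tPow i (-n)) := by
      rw [mul_neg, sub_mul, tPow_mul]
      simp [tPow_zero]
    rw [this]
    exact (h n).mul_right _

theorem dvd_sub_substOne (p : Laurent 2) : tPow 0 1 - 1 ∣ p - substOne p := by
  induction p using AddMonoidAlgebra.induction_linear with
  | zero => simp
  | add p q hp hq =>
    rw [map_add, add_sub_add_comm]
    exact dvd_add hp hq
  | single k a =>
    have h : AddMonoidAlgebra.single k a =
        substOne (AddMonoidAlgebra.single k a) * tPow 0 (k 0) := by
      simp only [substOne, tPow, AddMonoidAlgebra.mapDomainRingHom_apply,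
        AddMonoidAlgebra.mapDomain_single, AddMonoidAlgebra.single_mul_single]
      congr 1
      · ext i; fin_cases i <;> simp
      · simp
    nth_rewrite 1 [h]
    rw [← mul_sub_one]
    exact (tPow_sub_one_dvd _ _).mul_left _

theorem tPow_sub_one_ne_zero {μ : ℕ} (i : Fin μ) : (tPow i 1 - 1 : Laurent μ) ≠ 0 := by
  rw [sub_ne_zero, tPow, AddMonoidAlgebra.one_def]
  intro h
  have := (AddMonoidAlgebra.single_left_inj (one_ne_zero)).1 h
  simpa using congrFun this i

/-- The two factors are coprime: if `E (t_2 - 1) = F (t_1 - 1)`, then setting `t_1 = 1` kills `E`,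
so `t_1 - 1` divides `E` and can be cancelled from `D E = S (t_1 - 1)`. -/
theorem dvd_of_dvd_mul_tPow_sub_one {D S : Laurent 2} (h0 : D ∣ S * (tPow 0 1 - 1))
    (h1 : D ∣ S * (tPow 1 1 - 1)) : D ∣ S := by
  obtain ⟨E, hE⟩ := h0
  obtain ⟨F, hF⟩ := h1
  rcases eq_or_ne D 0 with rfl | hD
  · have : S = 0 := by simpa [tPow_sub_one_ne_zero] using hE
    simp [this]
  have h : E * (tPow 1 1 - 1) = F * (tPow 0 1 - 1) := by
    apply mul_left_cancel₀ hD
    rw [← mul_assoc, ← mul_assoc, ← hE, ← hF]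
    ring
  have h2 := congrArg substOne h
  simp only [map_mul, map_sub, substOne_tPow_one, substOne_tPow_zero, map_one, sub_self,
    mul_zero, mul_eq_zero, tPow_sub_one_ne_zero, or_false] at h2
  obtain ⟨E', hE'⟩ := dvd_sub_substOne E
  rw [h2, sub_zero] at hE'
  refine ⟨E', mul_right_cancel₀ (tPow_sub_one_ne_zero 0) ?_⟩
  rw [hE, hE']
  ring

/-- Up to the unit `e`, every entry of the Alexander matrix is a multiple of `S`, and the second row
is `-S (t_2 - 1)`, `S (t_1 - 1)`; hence the entries have greatest common divisor `S`. The unit lets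
the same `S` serve both chiralities: `e = 1` for `l`, and `e = -T ^ (-l)` for `-l`. -/
theorem isAlexanderPolynomial_torusBraid {k : ℤ} {S a e : Laurent 2} (he : IsUnit e)
    (hS : e * S * (tPow 0 1 * tPow 1 1 - 1) = a - 1)
    (h : ∀ j, ((foxUnit (id : Fin 2 → Fin 2) j 0 * foxUnit id j 1) ^ k).val =
      !![a, e * S * (if j = 0 then 1 else tPow 0 1); 0, 1]) :
    IsAlexanderPolynomial id (torusBraid k : BraidGroup 2) S := by
  intro D
  have hdet (r s : Fin (2 - 1) ↪o Fin 2) :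
      ((alexanderMatrix id (torusBraid k : BraidGroup 2)).submatrix r s).det =
        alexanderMatrix id (torusBraid k : BraidGroup 2) (r 0) (s 0) :=
    Matrix.det_fin_one _
  constructor
  · intro hD r s
    rw [hdet, alexanderMatrix_apply k _ _ (h _), ← hS]
    exact dvd_add (((hD.mul_left _).mul_right _).mul_left _)
      (((hD.mul_left _).mul_right _).mul_right _)
  · intro hD
    have hc (i : Fin 2) : ∃ r : Fin (2 - 1) ↪o Fin 2, r 0 = i :=
      ⟨OrderEmbedding.ofStrictMono (fun _ => i) (fun x y hxy => by
        have := Subsingleton.elim (α := Fin 1) x y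
        exact absurd hxy (this ▸ lt_irrefl _)), rfl⟩
    obtain ⟨r0, hr0⟩ := hc 0
    obtain ⟨r1, hr1⟩ := hc 1
    have h10 := hD r1 r0
    have h11 := hD r1 r1
    rw [hdet, hr1, hr0, alexanderMatrix_apply k _ _ (h _), ← hS] at h10
    rw [hdet, hr1, alexanderMatrix_apply k _ _ (h _), ← hS] at h11
    apply dvd_of_dvd_mul_tPow_sub_one
    · rw [← he.dvd_mul_left]
      convert h11 using 1
      simp
      ring
    · rw [← he.dvd_mul_left, ← dvd_neg]
      convert h10 using 1
      simp
      ring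

theorem isAlexanderPolynomial_torusBraid_natCast (l : ℕ) :
    IsAlexanderPolynomial id (torusBraid l : BraidGroup 2) (geomLaurent l) := by
  refine isAlexanderPolynomial_torusBraid (e := 1) (a := (tPow 0 1 * tPow 1 1) ^ l)
    isUnit_one ?_ fun j => ?_
  · rw [one_mul, geomLaurent_mul]
  · rw [zpow_natCast, foxUnit_pow, one_mul]

theorem isAlexanderPolynomial_torusBraid_neg (l : ℕ) :
    IsAlexanderPolynomial id (torusBraid (-l) : BraidGroup 2) (geomLaurent l) := by
  have h : ((tPow 0 (-1) * tPow 1 (-1)) * (tPow 0 1 * tPow 1 1) : Laurent 2) = 1 := by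
    rw [mul_mul_mul_comm, tPow_mul, tPow_mul]
    simp [tPow_zero]
  refine isAlexanderPolynomial_torusBraid (e := -(tPow 0 (-1) * tPow 1 (-1)) ^ l)
    (IsUnit.neg ((IsUnit.of_mul_eq_one _ h).pow l)) ?_ fun j => foxUnit_neg_pow j l
  rw [mul_assoc, geomLaurent_mul, mul_sub, mul_one, neg_mul, ← mul_pow, h]
  ring

theorem evalLaurent_geomLaurent (ω : Fin 2 → ℂ) (l : ℕ) :
    evalLaurent ω (geomLaurent l) = ∑ i ∈ Finset.range l, (ω 0 * ω 1) ^ i := by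
  have hadd (p q : Laurent 2) : evalLaurent ω (p + q) = evalLaurent ω p + evalLaurent ω q := by
    unfold evalLaurent
    rw [AddMonoidAlgebra.coeff_add]
    exact Finsupp.sum_add_index' (by simp) (by intros; push_cast; ring)
  induction l with
  | zero => simp [geomLaurent, evalLaurent]
  | succ l ih =>
    rw [Finset.sum_range_succ, ← ih, geomLaurent, Finset.sum_range_succ, hadd]
    congr 1
    rw [mul_pow, tPow_pow, tPow_pow]
    simp [tPow, AddMonoidAlgebra.single_mul_single, evalLaurent, mul_pow]

/-- A zero of the geometric sum is an `l`-th root of unity, but not `1`, where the sum equals `l`.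
The second clause is what rules out `m = l` later. -/
theorem exists_int_of_geom_sum_eq_zero {l : ℕ} (hl : 0 < l) {x : ℝ}
    (h : ∑ i ∈ Finset.range l, Complex.exp (2 * Complex.I * x) ^ i = 0) :
    (∃ m : ℤ, x = Real.pi * m / l) ∧ ∀ m : ℤ, x ≠ Real.pi * m := by
  have hl' : (l : ℝ) ≠ 0 := by positivity
  constructor
  · have h1 : Complex.exp (2 * Complex.I * x) ^ l = 1 := by
      have := geom_sum_mul (Complex.exp (2 * Complex.I * x)) l
      rw [h, zero_mul] at this
      exact (sub_eq_zero.1 this.symm)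
    rw [← Complex.exp_nat_mul, Complex.exp_eq_one_iff] at h1
    obtain ⟨m, hm⟩ := h1
    refine ⟨m, ?_⟩
    have h2 : (l : ℂ) * x = m * Real.pi := by
      have h3 : (2 * Complex.I) * ((l : ℂ) * x) = (2 * Complex.I) * (m * Real.pi) := by
        rw [← mul_assoc] at hm
        linear_combination hm
      exact mul_left_cancel₀ (by simp) h3
    have h4 : (l : ℝ) * x = m * Real.pi := by exact_mod_cast h2
    field_simp
    linarith
  · rintro m rfl
    have h1 : Complex.exp (2 * Complex.I * ((Real.pi * m : ℝ) : ℂ)) = 1 := by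
      rw [Complex.exp_eq_one_iff]
      exact ⟨m, by push_cast; ring⟩
    rw [h1] at h
    simp at h
    omega

theorem alexanderNonvanishing_torusBraid {l : ℕ} (hl : 0 < l) {α : Fin 2 → ℝ}
    (hα : ∀ i, 0 < α i ∧ α i < Real.pi) (hroot : α ∉ rootSet l) {β : BraidGroup 2}
    (hβ : IsAlexanderPolynomial id β (geomLaurent l)) : AlexanderNonvanishing id β α := by
  have hl' : (0 : ℝ) < l := by exact_mod_cast hl
  have key (x : ℝ) (hx0 : 0 < x) (hx1 : x < 2 * Real.pi)
      (hx : x = α 0 + α 1 ∨ x = α 0 - α 1 + Real.pi) (m : ℤ) (hm : x = Real.pi * m / l)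
      (hn : ∀ m : ℤ, x ≠ Real.pi * m) : False := by
    have hxl : x * l = Real.pi * m := by rw [hm]; field_simp
    have hm0 : 0 < m := by
      have : 0 < Real.pi * m := by rw [← hxl]; positivity
      exact_mod_cast pos_of_mul_pos_right this Real.pi_pos.le
    have hm1 : m < 2 * l := by
      have : Real.pi * m < Real.pi * (2 * l) := by rw [← hxl]; nlinarith
      exact_mod_cast lt_of_mul_lt_mul_left this Real.pi_pos.le
    have hm2 : m ≠ l := by
      rintro rfl
      apply hn 1
      rw [hm]
      push_cast
      field_simp
    apply hroot
    refine ⟨m, ?_, ?_⟩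
    · rw [abs_of_pos (by exact_mod_cast hl)]
      omega
    · have : |((l : ℤ) : ℝ)| = l := by simp
      rw [this, ← hm]
      rcases hx with rfl | rfl <;> simp
  have h0 := hα 0
  have h1 := hα 1
  refine ⟨_, hβ, fun ε h => ?_⟩
  rw [evalLaurent_geomLaurent, ← Complex.exp_add] at h
  have h2 : ∀ x : ℝ, ((ε 0 : ℤ) : ℝ) * α 0 + ((ε 1 : ℤ) : ℝ) * α 1 = x →
      (∃ m : ℤ, x = Real.pi * m / l) ∧ ∀ m : ℤ, x ≠ Real.pi * m := by
    rintro x rfl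
    apply exists_int_of_geom_sum_eq_zero hl
    rw [← h]
    congr! 3
    push_cast
    ring
  clear h
  have hneg (x : ℝ) (hx : (∃ m : ℤ, -x = Real.pi * m / l) ∧ ∀ m : ℤ, -x ≠ Real.pi * m) :
      (∃ m : ℤ, x = Real.pi * m / l) ∧ ∀ m : ℤ, x ≠ Real.pi * m := by
    obtain ⟨⟨m, hm⟩, hn⟩ := hx
    refine ⟨⟨-m, by push_cast; linear_combination -hm⟩, fun m h => hn (-m) ?_⟩
    push_cast
    linear_combination -h
  -- `exp (2 i x)` has period `π`, so the difference `α 0 - α 1` may be moved into the interval `(0,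
  -- 2π)` used by `rootSet`.
  have hshift (x : ℝ) (hx : (∃ m : ℤ, x = Real.pi * m / l) ∧ ∀ m : ℤ, x ≠ Real.pi * m) :
      (∃ m : ℤ, x + Real.pi = Real.pi * m / l) ∧ ∀ m : ℤ, x + Real.pi ≠ Real.pi * m := by
    obtain ⟨⟨m, hm⟩, hn⟩ := hx
    refine ⟨⟨m + l, by rw [hm]; push_cast; field_simp⟩, fun m h => hn (m - 1) ?_⟩
    push_cast
    linear_combination h
  have hplus : ¬ ((∃ m : ℤ, α 0 + α 1 = Real.pi * m / l) ∧ ∀ m : ℤ, α 0 + α 1 ≠ Real.pi * m) := by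
    rintro ⟨⟨m, hm⟩, hn⟩
    exact key _ (by linarith) (by linarith) (Or.inl rfl) m hm hn
  have hminus :
      ¬ ((∃ m : ℤ, α 0 - α 1 = Real.pi * m / l) ∧ ∀ m : ℤ, α 0 - α 1 ≠ Real.pi * m) := by
    intro hx
    obtain ⟨⟨m, hm⟩, hn⟩ := hshift _ hx
    exact key _ (by linarith) (by linarith) (Or.inr rfl) m hm hn
  rcases Int.units_eq_one_or (ε 0) with e0 | e0 <;> rcases Int.units_eq_one_or (ε 1) with e1 | e1 <;>
    simp only [e0, e1, Units.val_one, Units.val_neg, Int.cast_one, Int.cast_neg, one_mul,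
      neg_mul] at h2
  · exact hplus (h2 _ rfl)
  · exact hminus (h2 _ (by ring))
  · exact hminus (hneg _ (h2 _ (by ring)))
  · exact hplus (hneg _ (h2 _ (by ring)))

/-! ## Quaternions -/

theorem ne_zero_of_norm_eq_one {q : ℍ[ℝ]} (h : ‖q‖ = 1) : q ≠ 0 := by
  rintro rfl
  simp at h

theorem sum_sq_of_norm_eq_one {q : ℍ[ℝ]} (h : ‖q‖ = 1) :
    q.re ^ 2 + q.imI ^ 2 + q.imJ ^ 2 + q.imK ^ 2 = 1 := by
  rw [← Quaternion.normSq_def', Quaternion.normSq_eq_norm_mul_self, h, one_mul]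

theorem inner_coords (x y : ℍ[ℝ]) :
    inner ℝ x y = x.re * y.re + x.imI * y.imI + x.imJ * y.imJ + x.imK * y.imK := by
  rw [Quaternion.inner_def]
  simp

theorem re_mul_comm (x y : ℍ[ℝ]) : (x * y).re = (y * x).re := by
  simp
  ring

theorem commute_im_iff {p x : ℍ[ℝ]} : Commute p.im x ↔ Commute p x := by
  have h : p.im = p - (p.re : ℍ[ℝ]) := by
    rw [eq_sub_iff_add_eq', Quaternion.re_add_im]
  have hc : Commute (p.re : ℍ[ℝ]) x := Quaternion.coe_commute _ _
  constructor
  · intro hp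
    rw [← Quaternion.re_add_im p]
    exact hc.add_left hp
  · intro hp
    rw [h]
    exact hp.sub_left hc

theorem im_sq {p : ℍ[ℝ]} (hp : ‖p‖ = 1) : p.im * p.im = ((p.re ^ 2 - 1 : ℝ) : ℍ[ℝ]) := by
  have := sum_sq_of_norm_eq_one hp
  rw [show p.re ^ 2 - 1 = -(p.imI ^ 2 + p.imJ ^ 2 + p.imK ^ 2) by linarith]
  ext <;> simp only [Quaternion.re_mul, Quaternion.imI_mul, Quaternion.imJ_mul,
    Quaternion.imK_mul, Quaternion.re_im, Quaternion.imI_im, Quaternion.imJ_im,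
    Quaternion.imK_im, Quaternion.re_coe, Quaternion.imI_coe, Quaternion.imJ_coe,
    Quaternion.imK_coe] <;> ring

theorem sin_arccos_sq {x : ℝ} (h0 : -1 ≤ x) (h1 : x ≤ 1) :
    Real.sin (Real.arccos x) ^ 2 = 1 - x ^ 2 := by
  rw [Real.sin_sq, Real.cos_arccos h0 h1]

theorem abs_re_le_one {p : ℍ[ℝ]} (hp : ‖p‖ = 1) : -1 ≤ p.re ∧ p.re ≤ 1 := by
  have := sum_sq_of_norm_eq_one hp
  constructor <;> nlinarith [sq_nonneg p.imI, sq_nonneg p.imJ, sq_nonneg p.imK]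

/-- De Moivre's formula for unit quaternions. -/
theorem pow_eq_cos_add_sin {p : ℍ[ℝ]} (hp : ‖p‖ = 1) (hs : Real.sin (Real.arccos p.re) ≠ 0)
    (k : ℕ) :
    p ^ k = (Real.cos (k * Real.arccos p.re) : ℍ[ℝ]) +
      ((Real.sin (k * Real.arccos p.re) / Real.sin (Real.arccos p.re) : ℝ) : ℍ[ℝ]) * p.im := by
  obtain ⟨h0, h1⟩ := abs_re_le_one hp
  have hcos := Real.cos_arccos h0 h1
  have hsin := sin_arccos_sq h0 h1
  set φ := Real.arccos p.re with hφ
  induction k with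
  | zero => simp
  | succ k ih =>
    have hc : Real.cos ((k + 1 : ℕ) * φ) =
        Real.cos (k * φ) * Real.cos φ - Real.sin (k * φ) * Real.sin φ := by
      rw [← Real.cos_add]; push_cast; ring_nf
    have hs' : Real.sin ((k + 1 : ℕ) * φ) =
        Real.sin (k * φ) * Real.cos φ + Real.cos (k * φ) * Real.sin φ := by
      rw [← Real.sin_add]; push_cast; ring_nf
    have hi := im_sq hp
    have e1 : Real.cos ((k + 1 : ℕ) * φ) =
        Real.cos (k * φ) * p.re + Real.sin (k * φ) / Real.sin φ * (p.re ^ 2 - 1) := by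
      rw [hc, hcos]
      field_simp
      linear_combination (-Real.sin (k * φ)) * hsin
    have e2 : Real.sin ((k + 1 : ℕ) * φ) / Real.sin φ =
        Real.cos (k * φ) + Real.sin (k * φ) / Real.sin φ * p.re := by
      rw [hs', hcos]
      field_simp
      ring
    rw [pow_succ, ih, e1, e2]
    have hsplit : p = (p.re : ℍ[ℝ]) + p.im := by rw [Quaternion.re_add_im]
    generalize hC : Real.cos (k * φ) = C
    generalize hS : Real.sin (k * φ) / Real.sin φ = S
    calc ((C : ℍ[ℝ]) + (S : ℍ[ℝ]) * p.im) * p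
        = ((C : ℍ[ℝ]) + (S : ℍ[ℝ]) * p.im) * ((p.re : ℍ[ℝ]) + p.im) := by
          rw [← hsplit]
      _ = (C : ℍ[ℝ]) * p.re + (C : ℍ[ℝ]) * p.im + S * (p.im * p.re) + S * (p.im * p.im) := by
          noncomm_ring
      _ = _ := by
          rw [hi, ← Quaternion.coe_commutes p.re p.im]
          push_cast
          noncomm_ring

/-- With `φ = arccos (Re p)`, the imaginary part of `p ^ l` is `sin (l φ) / sin φ` times that of
`p`. If this factor were non-zero, whatever commutes with `p ^ l` would commute with `p`. -/
theorem sin_eq_zero_of_commute {p x : ℍ[ℝ]} (hp : ‖p‖ = 1) {l : ℕ} (h : Commute (p ^ l) x)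
    (hx : ¬ Commute p x) :
    Real.sin (l * Real.arccos p.re) = 0 ∧ p ^ l = (Real.cos (l * Real.arccos p.re) : ℍ[ℝ]) := by
  obtain ⟨h0, h1⟩ := abs_re_le_one hp
  have hs : Real.sin (Real.arccos p.re) ≠ 0 := by
    intro hs
    have h2 := sin_arccos_sq h0 h1
    have h3 := im_sq hp
    rw [hs] at h2
    rw [show p.re ^ 2 - 1 = 0 by linarith, Quaternion.coe_zero, mul_self_eq_zero] at h3
    apply hx
    rw [← commute_im_iff, h3]
    exact Commute.zero_left x
  have hz : Real.sin (l * Real.arccos p.re) = 0 := by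
    by_contra hne
    apply hx
    rw [← commute_im_iff]
    have hd : Real.sin (l * Real.arccos p.re) / Real.sin (Real.arccos p.re) ≠ 0 :=
      div_ne_zero hne hs
    rw [pow_eq_cos_add_sin hp hs] at h
    have h4 := h.sub_left (Quaternion.coe_commute (Real.cos (l * Real.arccos p.re)) x)
    rw [add_sub_cancel_left, Quaternion.coe_mul_eq_smul] at h4
    have h5 := h4.smul_left (Real.sin (l * Real.arccos p.re) / Real.sin (Real.arccos p.re))⁻¹
    rwa [smul_smul, inv_mul_cancel₀ hd, one_smul] at h5
  refine ⟨hz, ?_⟩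
  rw [pow_eq_cos_add_sin hp hs, hz]
  simp

/-- This is Lagrange's identity for the cross product: `[x, y] = 2 Im x × Im y`, and `Re x Re y - Re
(x y)` is the scalar product of the imaginary parts. It makes irreducibility of a pair with
prescribed traces a condition on `Re (x y)` alone. -/
theorem commutator_normSq {x y : ℍ[ℝ]} (hx : ‖x‖ = 1) (hy : ‖y‖ = 1) :
    Quaternion.normSq (x * y - y * x) =
      4 * ((1 - x.re ^ 2) * (1 - y.re ^ 2) - (x.re * y.re - (x * y).re) ^ 2) := by
  have h1 := sum_sq_of_norm_eq_one hx
  have h2 := sum_sq_of_norm_eq_one hy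
  rw [show 1 - x.re ^ 2 = x.imI ^ 2 + x.imJ ^ 2 + x.imK ^ 2 by linarith,
    show 1 - y.re ^ 2 = y.imI ^ 2 + y.imJ ^ 2 + y.imK ^ 2 by linarith]
  simp [Quaternion.normSq_def']
  ring

theorem commute_iff_re {x y : ℍ[ℝ]} (hx : ‖x‖ = 1) (hy : ‖y‖ = 1) :
    x * y = y * x ↔ (x.re * y.re - (x * y).re) ^ 2 = (1 - x.re ^ 2) * (1 - y.re ^ 2) := by
  rw [← sub_eq_zero, ← Quaternion.normSq_eq_zero, commutator_normSq hx hy]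
  constructor <;> intro h <;> linarith

theorem not_commute_mul {x y : ℍ[ℝ]} (h : x * y ≠ y * x) :
    ¬ Commute (x * y) x ∧ ¬ Commute (x * y) y := by
  have hx : x ≠ 0 := by rintro rfl; simp at h
  have hy : y ≠ 0 := by rintro rfl; simp at h
  constructor
  · intro hc
    apply h
    have := hc.eq
    rw [mul_assoc] at this
    exact (mul_left_cancel₀ hx this).symm
  · intro hc
    apply h
    have := hc.eq
    rw [← mul_assoc] at this
    exact mul_right_cancel₀ hy this

theorem isIrreducible_fin_two {X : Fin 2 → ℍ[ℝ]} : IsIrreducible X ↔ X 0 * X 1 ≠ X 1 * X 0 := by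
  constructor
  · rintro ⟨i, j, h⟩
    fin_cases i <;> fin_cases j
    · exact absurd rfl h
    · exact h
    · exact h.symm
    · exact absurd rfl h
  · exact fun h => ⟨0, 1, h⟩

theorem repSpace_ne_zero {N : ℕ} {θ : Fin N → ℝ} {X : Fin N → ℍ[ℝ]} (h : X ∈ repSpace θ)
    (i : Fin N) : X i ≠ 0 :=
  ne_zero_of_norm_eq_one (h i).1

/-! ## The intersection points -/

theorem graphMap_eq_diag {n : ℕ} {β : BraidGroup n} {X Z : Fin n → ℍ[ℝ]} :
    graphMap β X = diag Z ↔ Z = X ∧ tupleAct X β = X := by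
  constructor
  · intro h
    have h1 : X = Z := by
      funext i
      simpa only [graphMap, diag, Fin.append_left] using congrFun h (Fin.castAdd n i)
    have h2 : tupleAct X β = Z := by
      funext i
      simpa only [graphMap, diag, Fin.append_right] using congrFun h (Fin.natAdd n i)
    exact ⟨h1.symm, h2.trans h1.symm⟩
  · rintro ⟨rfl, h⟩
    rw [graphMap, h, diag]

theorem tupleAct_torusBraid_eq_self {k : ℤ} {X : Fin 2 → ℍ[ℝ]} (hX : ∀ i, X i ≠ 0) :
    tupleAct X (torusBraid k : BraidGroup 2) = X ↔ ∀ j, Commute ((X 0 * X 1) ^ k) (X j) := by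
  rw [funext_iff]
  refine forall_congr' fun j => ?_
  rw [tupleAct_torusBraid k X hX, mul_inv_eq_iff_eq_mul₀ (zpow_ne_zero _ (mul_ne_zero (hX 0) (hX 1)))]
  rfl

theorem tupleAct_torusBraid_neg_eq_self {k : ℤ} {X : Fin 2 → ℍ[ℝ]} (hX : ∀ i, X i ≠ 0) :
    tupleAct X (torusBraid (-k) : BraidGroup 2) = X ↔
      tupleAct X (torusBraid k : BraidGroup 2) = X := by
  rw [tupleAct_torusBraid_eq_self hX, tupleAct_torusBraid_eq_self hX]
  simp [zpow_neg, Commute.inv_left_iff₀]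

theorem mem_meets_graphMap {n : ℕ} {θ : Fin n → ℝ} {β : BraidGroup n} {X : Fin n → ℍ[ℝ]} :
    X ∈ meets θ (graphMap β) ↔ X ∈ irrRep θ ∧ tupleAct X β = X := by
  simp [meets, graphMap_eq_diag]

theorem meets_torusBraid_neg (θ : Fin 2 → ℝ) (k : ℤ) :
    meets θ (graphMap (torusBraid (-k) : BraidGroup 2)) =
      meets θ (graphMap (torusBraid k : BraidGroup 2)) := by
  ext X
  rw [mem_meets_graphMap, mem_meets_graphMap]
  exact and_congr_right fun h => tupleAct_torusBraid_neg_eq_self (repSpace_ne_zero h.1)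

theorem commute_pow_of_mem_meets {θ : Fin 2 → ℝ} {l : ℕ} {X : Fin 2 → ℍ[ℝ]}
    (hX : X ∈ meets θ (graphMap (torusBraid l : BraidGroup 2))) (j : Fin 2) :
    Commute ((X 0 * X 1) ^ l) (X j) := by
  rw [mem_meets_graphMap] at hX
  have := (tupleAct_torusBraid_eq_self (repSpace_ne_zero hX.1.1)).1 hX.2 j
  rwa [zpow_natCast] at this

theorem norm_mul_of_mem_repSpace {θ : Fin 2 → ℝ} {X : Fin 2 → ℍ[ℝ]} (h : X ∈ repSpace θ) :
    ‖X 0 * X 1‖ = 1 := by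
  rw [norm_mul, (h 0).1, (h 1).1, one_mul]

/-- Irreducibility is an open condition, but here it only removes points from a finite set of values
of `Re (X 0 * X 1)`, so the intersection is closed. The values for `m = 0` and `m = l` are harmless:
there the product is `1` or `-1`, the entries commute, and the second set discards them. -/
theorem meets_torusBraid {l : ℕ} (hl : 0 < l) (θ : Fin 2 → ℝ) :
    meets θ (graphMap (torusBraid l : BraidGroup 2)) =
      {X | X ∈ repSpace θ ∧ (X 0 * X 1).re ∈
        {x | ∃ m ∈ Finset.range (l + 1), Real.cos (m * Real.pi / l) = x} ∩
        {x | (Real.cos (θ 0) * Real.cos (θ 1) - x) ^ 2 ≠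
          (1 - Real.cos (θ 0) ^ 2) * (1 - Real.cos (θ 1) ^ 2)}} := by
  have hl' : (0 : ℝ) < l := by exact_mod_cast hl
  ext X
  have hre (h : X ∈ repSpace θ) (i : Fin 2) : (X i).re = Real.cos (θ i) := by
    have := (h i).2
    linarith
  have hirr (h : X ∈ repSpace θ) : IsIrreducible X ↔
      (Real.cos (θ 0) * Real.cos (θ 1) - (X 0 * X 1).re) ^ 2 ≠
          (1 - Real.cos (θ 0) ^ 2) * (1 - Real.cos (θ 1) ^ 2) := by
    rw [isIrreducible_fin_two, Ne, commute_iff_re (h 0).1 (h 1).1, hre h, hre h]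
  constructor
  · intro hX
    have hc := commute_pow_of_mem_meets hX 0
    have h := hX.1.1
    refine ⟨h, ?_, (hirr h).1 hX.1.2⟩
    have hp := norm_mul_of_mem_repSpace h
    obtain ⟨hs, -⟩ := sin_eq_zero_of_commute hp hc
      (not_commute_mul (isIrreducible_fin_two.1 hX.1.2)).1
    obtain ⟨h0, h1⟩ := abs_re_le_one hp
    obtain ⟨m, hm⟩ := Real.sin_eq_zero_iff.1 hs
    have hm' : (m : ℝ) * Real.pi / l = Real.arccos (X 0 * X 1).re := by
      rw [hm]; field_simp
    have hm0 : 0 ≤ m := by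
      have : 0 ≤ (m : ℝ) * Real.pi := by rw [hm]; have := Real.arccos_nonneg (X 0 * X 1).re; positivity
      exact_mod_cast nonneg_of_mul_nonneg_left this Real.pi_pos
    have hm1 : m ≤ l := by
      have : (m : ℝ) * Real.pi ≤ l * Real.pi := by
        rw [hm]
        exact mul_le_mul_of_nonneg_left (Real.arccos_le_pi _) hl'.le
      exact_mod_cast le_of_mul_le_mul_right this Real.pi_pos
    lift m to ℕ using hm0
    refine ⟨m, Finset.mem_range.2 (by omega), ?_⟩
    rw [Int.cast_natCast] at hm'
    rw [hm', Real.cos_arccos h0 h1]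
  · rintro ⟨h, ⟨m, hm, hmx⟩, hne⟩
    rw [mem_meets_graphMap]
    have hi := (hirr h).2 hne
    refine ⟨⟨h, hi⟩, (tupleAct_torusBraid_eq_self (repSpace_ne_zero h)).2 fun j => ?_⟩
    rw [zpow_natCast]
    have hp := norm_mul_of_mem_repSpace h
    obtain ⟨h0, h1⟩ := abs_re_le_one hp
    have hφ : Real.arccos (X 0 * X 1).re = m * Real.pi / l := by
      rw [← hmx, Real.arccos_cos (by positivity)]
      rw [div_le_iff₀ hl', mul_comm]
      have : (m : ℝ) ≤ l := by exact_mod_cast Nat.lt_succ_iff.1 (Finset.mem_range.1 hm)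
      exact mul_le_mul_of_nonneg_left this Real.pi_pos.le
    have hsz : Real.sin (l * Real.arccos (X 0 * X 1).re) = 0 := by
      rw [hφ, mul_div_cancel₀ _ hl'.ne']
      exact Real.sin_nat_mul_pi m
    have hs : Real.sin (Real.arccos (X 0 * X 1).re) ≠ 0 := by
      intro hs
      have h2 := sin_arccos_sq h0 h1
      have h3 := im_sq hp
      rw [hs] at h2
      rw [show (X 0 * X 1).re ^ 2 - 1 = 0 by linarith, Quaternion.coe_zero, mul_self_eq_zero] at h3
      apply (not_commute_mul (isIrreducible_fin_two.1 hi)).1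
      rw [← commute_im_iff, h3]
      exact Commute.zero_left _
    rw [pow_eq_cos_add_sin hp hs, hsz]
    simpa using Quaternion.coe_commute _ _

theorem isCompact_meets_torusBraid {l : ℕ} (hl : 0 < l) (θ : Fin 2 → ℝ) :
    IsCompact (meets θ (graphMap (torusBraid l : BraidGroup 2))) := by
  rw [meets_torusBraid hl]
  have hF : IsClosed ({x | ∃ m ∈ Finset.range (l + 1), Real.cos (m * Real.pi / l) = x} ∩
        {x | (Real.cos (θ 0) * Real.cos (θ 1) - x) ^ 2 ≠
          (1 - Real.cos (θ 0) ^ 2) * (1 - Real.cos (θ 1) ^ 2)}) := by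
    apply Set.Finite.isClosed
    apply Set.Finite.inter_of_left
    exact (Finset.range (l + 1)).finite_toSet.image fun m : ℕ => Real.cos (m * Real.pi / l)
  apply Metric.isCompact_of_isClosed_isBounded
  · apply IsClosed.inter
    · simp only [repSpace, Set.ofPred_forall]
      refine isClosed_iInter fun i => IsClosed.inter ?_ ?_
      · exact isClosed_eq (by fun_prop) continuous_const
      · exact isClosed_eq (continuous_const.mul
          (Quaternion.continuous_re.comp (continuous_apply i))) continuous_const
    · exact hF.preimage (Quaternion.continuous_re.comp
        ((continuous_apply 0).mul (continuous_apply 1)))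
  · refine (Metric.isBounded_closedBall (x := (0 : Fin 2 → ℍ[ℝ])) (r := 1)).subset ?_
    rintro X ⟨hX, -⟩
    rw [mem_closedBall_zero_iff, pi_norm_le_iff_of_nonneg zero_le_one]
    exact fun i => (hX i).1.le

theorem compactSpace_intersectionPoints {n : ℕ} {θ : Fin n → ℝ}
    {G : (Fin n → ℍ[ℝ]) → Fin (n + n) → ℍ[ℝ]} (h : IsCompact (meets θ G)) :
    CompactSpace (IntersectionPoints θ G) := by
  have := isCompact_iff_compactSpace.1 h
  exact Quotient.compactSpace

/-! ## The derivative of the graph -/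

theorem fderiv_mul_apply {E : Type*} [NormedAddCommGroup E] [NormedSpace ℝ E] {f g : E → ℍ[ℝ]}
    {X : E} (hf : DifferentiableAt ℝ f X) (hg : DifferentiableAt ℝ g X) (b : E) :
    fderiv ℝ (fun Y => f Y * g Y) X b = f X * fderiv ℝ g X b + fderiv ℝ f X b * g X := by
  rw [fderiv_fun_mul' hf hg]
  rfl

theorem differentiableAt_inv_comp {E : Type*} [NormedAddCommGroup E] [NormedSpace ℝ E]
    {f : E → ℍ[ℝ]} {X : E} (hf : DifferentiableAt ℝ f X) (h0 : f X ≠ 0) :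
    DifferentiableAt ℝ (fun Y => (f Y)⁻¹) X :=
  (differentiableAt_inv h0).comp X hf

theorem fderiv_eval {N : ℕ} (X b : Fin N → ℍ[ℝ]) (j : Fin N) :
    fderiv ℝ (fun Y : Fin N → ℍ[ℝ] => Y j) X b = b j :=
  DFunLike.congr_fun (hasFDerivAt_apply (𝕜 := ℝ) j X).fderiv b

/-- Differentiate `(f g f⁻¹) f = f g` where `f` is a real scalar, hence central; the derivative of
`f⁻¹` is never needed. -/
theorem fderiv_conj_apply {E : Type*} [NormedAddCommGroup E] [NormedSpace ℝ E] {f g : E → ℍ[ℝ]}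
    {X : E} (hf : DifferentiableAt ℝ f X) (hg : DifferentiableAt ℝ g X) {r : ℝ} (hr : r ≠ 0)
    (hX : f X = r) (b : E) :
    fderiv ℝ (fun Y => f Y * g Y * (f Y)⁻¹) X b =
      fderiv ℝ g X b + r⁻¹ • (fderiv ℝ f X b * g X - g X * fderiv ℝ f X b) := by
  have hr' : (r : ℍ[ℝ]) ≠ 0 := Quaternion.coe_injective.ne hr
  have h0 : f X ≠ 0 := by rwa [hX]
  have hd : DifferentiableAt ℝ (fun Y => f Y * g Y * (f Y)⁻¹) X :=
    (hf.mul hg).mul (differentiableAt_inv_comp hf h0)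
  have he : (fun Y => f Y * g Y * (f Y)⁻¹ * f Y) =ᶠ[nhds X] fun Y => f Y * g Y := by
    filter_upwards [hf.continuousAt.eventually_ne h0] with Y hY
    rw [inv_mul_cancel_right₀ hY]
  have h := DFunLike.congr_fun (he.fderiv_eq (𝕜 := ℝ)) b
  simp only [fderiv_mul_apply hd hf, fderiv_mul_apply hf hg, hX] at h
  rw [Quaternion.coe_commutes r (g X), mul_inv_cancel_right₀ hr',
    ← Quaternion.coe_commutes, Quaternion.coe_mul_eq_smul, Quaternion.coe_mul_eq_smul] at h
  have h2 : r • fderiv ℝ (fun Y => f Y * g Y * (f Y)⁻¹) X b =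
      r • fderiv ℝ g X b + (fderiv ℝ f X b * g X - g X * fderiv ℝ f X b) := by
    rw [← add_sub_assoc, ← h, add_sub_cancel_left]
  rw [← inv_smul_smul₀ hr (fderiv ℝ (fun Y => f Y * g Y * (f Y)⁻¹) X b), h2, smul_add,
    inv_smul_smul₀ hr]

/-- At a real value `r` the derivative of `f⁻¹` is `-r⁻² df`, and dividing by `r⁻¹` leaves `-r⁻¹
df`. This minus sign is the source of the sign in the corollary. -/
theorem fderiv_inv_conj_apply {E : Type*} [NormedAddCommGroup E] [NormedSpace ℝ E]
    {f g : E → ℍ[ℝ]}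
    {X : E} (hf : DifferentiableAt ℝ f X) (hg : DifferentiableAt ℝ g X) {r : ℝ} (hr : r ≠ 0)
    (hX : f X = r) (b : E) :
    fderiv ℝ (fun Y => (f Y)⁻¹ * g Y * (f Y)⁻¹⁻¹) X b =
      fderiv ℝ g X b - r⁻¹ • (fderiv ℝ f X b * g X - g X * fderiv ℝ f X b) := by
  have hr' : (r : ℍ[ℝ]) ≠ 0 := Quaternion.coe_injective.ne hr
  have h0 : f X ≠ 0 := by rwa [hX]
  have hd := differentiableAt_inv_comp hf h0
  have hi : fderiv ℝ (fun Y => (f Y)⁻¹) X b = -((r⁻¹ * r⁻¹) • fderiv ℝ f X b) := by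
    have he : (fun Y => f Y * (f Y)⁻¹) =ᶠ[nhds X] fun _ => 1 := by
      filter_upwards [hf.continuousAt.eventually_ne h0] with Y hY
      exact mul_inv_cancel₀ hY
    have h := DFunLike.congr_fun (he.fderiv_eq (𝕜 := ℝ)) b
    simp only [fderiv_mul_apply hf hd, hX, ← Quaternion.coe_inv, ← Quaternion.coe_commutes,
      Quaternion.coe_mul_eq_smul, fderiv_fun_const, Pi.zero_apply,
      zero_apply] at h
    rw [← inv_smul_smul₀ hr (fderiv ℝ (fun Y => (f Y)⁻¹) X b), eq_neg_of_add_eq_zero_left h,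
      smul_neg, smul_smul]
  have hc (c : ℝ) (F G : ℍ[ℝ]) : -(c • F) * G - G * -(c • F) = -(c • (F * G - G * F)) := by
    rw [neg_mul, mul_neg, smul_mul_assoc, mul_smul_comm, smul_sub]
    abel
  rw [fderiv_conj_apply hd hg (inv_ne_zero hr) (by rw [hX, Quaternion.coe_inv]), hi, inv_inv,
    hc, smul_neg, smul_smul, mul_inv_cancel_left₀ hr, ← sub_eq_add_neg]

theorem differentiableAt_prod (X : Fin 2 → ℍ[ℝ]) :
    DifferentiableAt ℝ (fun Y : Fin 2 → ℍ[ℝ] => Y 0 * Y 1) X :=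
  (differentiableAt_apply 0 X).mul (differentiableAt_apply 1 X)

theorem differentiableAt_prod_pow (l : ℕ) (X : Fin 2 → ℍ[ℝ]) :
    DifferentiableAt ℝ (fun Y : Fin 2 → ℍ[ℝ] => (Y 0 * Y 1) ^ l) X :=
  (differentiableAt_prod X).pow l

theorem fderiv_prod_apply (X b : Fin 2 → ℍ[ℝ]) :
    fderiv ℝ (fun Y : Fin 2 → ℍ[ℝ] => Y 0 * Y 1) X b = X 0 * b 1 + b 0 * X 1 := by
  rw [fderiv_mul_apply (differentiableAt_apply 0 X) (differentiableAt_apply 1 X), fderiv_eval,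
    fderiv_eval]

theorem fderiv_append {n : ℕ} {g : (Fin n → ℍ[ℝ]) → Fin n → ℍ[ℝ]} {X : Fin n → ℍ[ℝ]}
    (hg : ∀ j, DifferentiableAt ℝ (fun Y => g Y j) X) (b : Fin n → ℍ[ℝ]) :
    fderiv ℝ (fun Y => Fin.append Y (g Y)) X b =
      Fin.append b fun j => fderiv ℝ (fun Y => g Y j) X b := by
  have hd : DifferentiableAt ℝ (fun Y => Fin.append Y (g Y)) X := by
    refine differentiableAt_pi.2 fun k => ?_
    refine Fin.addCases (fun i => ?_) (fun j => ?_) k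
    · simp only [Fin.append_left]
      exact differentiableAt_apply i X
    · simp only [Fin.append_right]
      exact hg j
  funext k
  have h := DFunLike.congr_fun (fderiv_apply hd k) b
  change _ = fderiv ℝ (fun Y => Fin.append Y (g Y)) X b k at h
  rw [← h]
  refine Fin.addCases (fun i => ?_) (fun j => ?_) k
  · simp only [Fin.append_left]
    exact fderiv_eval X b i
  · simp only [Fin.append_right]

theorem fderiv_graphMap {n : ℕ} {β : BraidGroup n} {g : (Fin n → ℍ[ℝ]) → Fin n → ℍ[ℝ]}
    {X : Fin n → ℍ[ℝ]} (hX : ∀ i, X i ≠ 0)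
    (hβ : ∀ Y : Fin n → ℍ[ℝ], (∀ i, Y i ≠ 0) → tupleAct Y β = g Y)
    (hg : ∀ j, DifferentiableAt ℝ (fun Y => g Y j) X) (b : Fin n → ℍ[ℝ]) :
    fderiv ℝ (graphMap β) X b = Fin.append b fun j => fderiv ℝ (fun Y => g Y j) X b := by
  rw [← fderiv_append hg]
  congr 1
  apply Filter.EventuallyEq.fderiv_eq
  have : ∀ᶠ Y in nhds X, ∀ i, Y i ≠ 0 :=
    Filter.eventually_all.2 fun i => (continuous_apply i).continuousAt.eventually_ne (hX i)
  filter_upwards [this] with Y hY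
  rw [graphMap, hβ Y hY]

theorem fderiv_graphMap_torusBraid {l : ℕ} {X : Fin 2 → ℍ[ℝ]} (hX : ∀ i, X i ≠ 0) {r : ℝ}
    (hr : r ≠ 0) (h : (X 0 * X 1) ^ l = r) (b : Fin 2 → ℍ[ℝ]) :
    fderiv ℝ (graphMap (torusBraid l : BraidGroup 2)) X b =
      Fin.append b fun j => b j + r⁻¹ •
        (fderiv ℝ (fun Y : Fin 2 → ℍ[ℝ] => (Y 0 * Y 1) ^ l) X b * X j -
          X j * fderiv ℝ (fun Y : Fin 2 → ℍ[ℝ] => (Y 0 * Y 1) ^ l) X b) := by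
  have hf := differentiableAt_prod_pow l X
  have h0 : (X 0 * X 1) ^ l ≠ 0 := pow_ne_zero _ (mul_ne_zero (hX 0) (hX 1))
  rw [fderiv_graphMap (g := fun Y j => (Y 0 * Y 1) ^ l * Y j * ((Y 0 * Y 1) ^ l)⁻¹) hX]
  · congr 1
    funext j
    rw [fderiv_conj_apply hf (differentiableAt_apply j X) hr h, fderiv_eval]
  · intro Y hY
    funext j
    rw [tupleAct_torusBraid _ _ hY, zpow_natCast]
  · intro j
    exact (hf.mul (differentiableAt_apply j X)).mul (differentiableAt_inv_comp hf h0)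

theorem fderiv_graphMap_torusBraid_neg {l : ℕ} {X : Fin 2 → ℍ[ℝ]} (hX : ∀ i, X i ≠ 0) {r : ℝ}
    (hr : r ≠ 0) (h : (X 0 * X 1) ^ l = r) (b : Fin 2 → ℍ[ℝ]) :
    fderiv ℝ (graphMap (torusBraid (-l) : BraidGroup 2)) X b =
      Fin.append b fun j => b j - r⁻¹ •
        (fderiv ℝ (fun Y : Fin 2 → ℍ[ℝ] => (Y 0 * Y 1) ^ l) X b * X j -
          X j * fderiv ℝ (fun Y : Fin 2 → ℍ[ℝ] => (Y 0 * Y 1) ^ l) X b) := by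
  have hf := differentiableAt_prod_pow l X
  have h0 : (X 0 * X 1) ^ l ≠ 0 := pow_ne_zero _ (mul_ne_zero (hX 0) (hX 1))
  have hd := differentiableAt_inv_comp hf h0
  rw [fderiv_graphMap (g := fun Y j => ((Y 0 * Y 1) ^ l)⁻¹ * Y j * ((Y 0 * Y 1) ^ l)⁻¹⁻¹) hX]
  · congr 1
    funext j
    rw [fderiv_inv_conj_apply hf (differentiableAt_apply j X) hr h, fderiv_eval]
  · intro Y hY
    funext j
    rw [tupleAct_torusBraid _ _ hY, zpow_neg, zpow_natCast]
  · intro j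
    exact (hd.mul (differentiableAt_apply j X)).mul
      (differentiableAt_inv_comp hd (inv_ne_zero h0))

theorem diag_add {n : ℕ} (a b : Fin n → ℍ[ℝ]) : diag (a + b) = diag a + diag b := by
  funext k
  refine Fin.addCases (fun i => ?_) (fun j => ?_) k <;>
    simp only [diag, Pi.add_apply, Fin.append_left, Fin.append_right]

theorem diag_smul {n : ℕ} (c : ℝ) (a : Fin n → ℍ[ℝ]) : diag (c • a) = c • diag a := by
  funext k
  refine Fin.addCases (fun i => ?_) (fun j => ?_) k <;>
    simp only [diag, Pi.smul_apply, Fin.append_left, Fin.append_right]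

theorem fderiv_graphMap_torusBraid_add {l : ℕ} {X : Fin 2 → ℍ[ℝ]} (hX : ∀ i, X i ≠ 0) {r : ℝ}
    (hr : r ≠ 0) (h : (X 0 * X 1) ^ l = r) (b : Fin 2 → ℍ[ℝ]) :
    fderiv ℝ (graphMap (torusBraid l : BraidGroup 2)) X b +
      fderiv ℝ (graphMap (torusBraid (-l) : BraidGroup 2)) X b = (2 : ℝ) • diag b := by
  rw [fderiv_graphMap_torusBraid hX hr h, fderiv_graphMap_torusBraid_neg hX hr h, two_smul]
  funext k
  refine Fin.addCases (fun i => ?_) (fun j => ?_) k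
  · simp only [diag, Pi.add_apply, Fin.append_left]
  · simp only [diag, Pi.add_apply, Fin.append_right]
    abel

/-! ## Transversality -/

theorem defect_eq (P : Fin (2 + 2) → ℍ[ℝ]) : defect P = P 0 * P 1 * (P 2 * P 3)⁻¹ := by
  simp only [defect, firstProd, secondProd, List.ofFn_succ, List.ofFn_zero, List.prod_cons,
    List.prod_nil, mul_one]
  rfl

/-- Since `defect` equals `1` on the diagonal, differentiating `defect P * (P 2 * P 3) = P 0 * P 1`
shows that in the kernel both products vary equally. -/
theorem fderiv_defect_diag {X : Fin 2 → ℍ[ℝ]} (hX : ∀ i, X i ≠ 0) {τ : Fin (2 + 2) → ℍ[ℝ]}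
    (h : fderiv ℝ defect (diag X) τ = 0) :
    X 0 * τ 3 + τ 2 * X 1 = X 0 * τ 1 + τ 0 * X 1 := by
  have d (i : Fin (2 + 2)) := differentiableAt_apply (𝕜 := ℝ) (F' := fun _ => ℍ[ℝ]) i (diag X)
  have d23 : DifferentiableAt ℝ (fun P : Fin (2 + 2) → ℍ[ℝ] => P 2 * P 3) (diag X) :=
    (d 2).mul (d 3)
  have e0 : diag X 0 = X 0 := rfl
  have e1 : diag X 1 = X 1 := rfl
  have e2 : diag X 2 = X 0 := rfl
  have e3 : diag X 3 = X 1 := rfl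
  have h23 : diag X 2 * diag X 3 ≠ 0 := mul_ne_zero (hX 0) (hX 1)
  have hdef : (defect : (Fin (2 + 2) → ℍ[ℝ]) → ℍ[ℝ]) =
      fun P => P 0 * P 1 * (P 2 * P 3)⁻¹ := funext defect_eq
  have hd : DifferentiableAt ℝ defect (diag X) := by
    rw [hdef]
    exact ((d 0).mul (d 1)).mul (differentiableAt_inv_comp d23 h23)
  have h1 : defect (diag X) = 1 := by
    rw [hdef]
    exact mul_inv_cancel₀ h23
  have he : (fun P : Fin (2 + 2) → ℍ[ℝ] => defect P * (P 2 * P 3)) =ᶠ[nhds (diag X)]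
      fun P => P 0 * P 1 := by
    filter_upwards [d23.continuousAt.eventually_ne h23] with P hP
    rw [defect_eq]
    exact inv_mul_cancel_right₀ hP _
  have h2 := DFunLike.congr_fun (he.fderiv_eq (𝕜 := ℝ)) τ
  simp only [fderiv_mul_apply hd d23, fderiv_mul_apply (d 2) (d 3),
    fderiv_mul_apply (d 0) (d 1), h, h1, fderiv_eval] at h2
  simpa [e0, e1, e2, e3] using h2

/-- Here `m = v × q` on imaginary parts, and an imaginary `d` orthogonal to `v` and `q` is parallel
to `m`. -/
theorem smul_eq_of_orthogonal {v q d m : ℍ[ℝ]} (hd : d.re = 0) (hm0 : m.re = 0)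
    (hv : d.imI * v.imI + d.imJ * v.imJ + d.imK * v.imK = 0)
    (hq : d.imI * q.imI + d.imJ * q.imJ + d.imK * q.imK = 0)
    (h1 : m.imI = v.imJ * q.imK - v.imK * q.imJ) (h2 : m.imJ = v.imK * q.imI - v.imI * q.imK)
    (h3 : m.imK = v.imI * q.imJ - v.imJ * q.imI) :
    (m.imI ^ 2 + m.imJ ^ 2 + m.imK ^ 2) • d =
      (d.imI * m.imI + d.imJ * m.imJ + d.imK * m.imK) • m := by
  ext
  · simp [hd, hm0]
  · simp only [Quaternion.imI_smul, smul_eq_mul, h1, h2, h3]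
    linear_combination ((v.imK * q.imI - v.imI * q.imK) * v.imK - (v.imI * q.imJ - v.imJ * q.imI) * v.imJ) * hq -
      ((v.imK * q.imI - v.imI * q.imK) * q.imK - (v.imI * q.imJ - v.imJ * q.imI) * q.imJ) * hv
  · simp only [Quaternion.imJ_smul, smul_eq_mul, h1, h2, h3]
    linear_combination ((v.imI * q.imJ - v.imJ * q.imI) * v.imI - (v.imJ * q.imK - v.imK * q.imJ) * v.imK) * hq -
      ((v.imI * q.imJ - v.imJ * q.imI) * q.imI - (v.imJ * q.imK - v.imK * q.imJ) * q.imK) * hv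
  · simp only [Quaternion.imK_smul, smul_eq_mul, h1, h2, h3]
    linear_combination ((v.imJ * q.imK - v.imK * q.imJ) * v.imJ - (v.imK * q.imI - v.imI * q.imK) * v.imI) * hq -
      ((v.imJ * q.imK - v.imK * q.imJ) * q.imJ - (v.imK * q.imI - v.imI * q.imK) * q.imI) * hv

/-- The infinitesimal variations of `(x, y)` that fix the product `x y` form a line, spanned by
conjugation in the direction `Im (x y)`. The vector `ε` is orthogonal to `Im y` and to `Im (ȳ x)`,
hence parallel to their cross product; `δ` is then determined by `ε`. -/
theorem exists_eq_smul_commutator {x y δ ε : ℍ[ℝ]} (hxy : x * y ≠ y * x) (hδ : δ.re = 0)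
    (hε : ε.re = 0) (hy : inner ℝ y ε = 0) (h : x * ε + δ * y = 0) :
    ∃ c : ℝ, δ = c • ((x * y).im * x - x * (x * y).im) ∧
      ε = c • ((x * y).im * y - y * (x * y).im) := by
  have hy0 : y ≠ 0 := by rintro rfl; simp at hxy
  set m := (x * y).im * y - y * (x * y).im with hm
  have hm0 : m ≠ 0 := by
    rw [hm, sub_ne_zero]
    intro hc
    exact (not_commute_mul hxy).2 (commute_im_iff.1 hc)
  have hnorm : (m.imI ^ 2 + m.imJ ^ 2 + m.imK ^ 2) ≠ 0 := by
    have hre : m.re = 0 := by simp [hm]; ring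
    intro h0
    apply hm0
    rw [← Quaternion.normSq_eq_zero, Quaternion.normSq_def', hre]
    linarith
  -- Multiply the equation by `ȳ` on the right and take real parts; `δ` contributes nothing, being
  -- imaginary.
  have hq : (ε * (star y * x)).re = 0 := by
    have h1 : x * ε * star y + (y * star y) * δ = 0 := by
      rw [Quaternion.self_mul_star, Quaternion.coe_commutes, ← Quaternion.self_mul_star, ← mul_assoc,
        ← add_mul, h, zero_mul]
    have h2 := congrArg (fun q : ℍ[ℝ] => q.re) h1
    simp only [Quaternion.self_mul_star, Quaternion.coe_mul_eq_smul, Quaternion.re_add,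
      Quaternion.re_smul, hδ, smul_zero, add_zero, Quaternion.re_zero] at h2
    rw [← mul_assoc, re_mul_comm, ← mul_assoc]
    exact h2
  have hv : ε.imI * y.imI + ε.imJ * y.imJ + ε.imK * y.imK = 0 := by
    rw [inner_coords, hε] at hy
    linarith
  have hq' : ε.imI * (star y * x).imI + ε.imJ * (star y * x).imJ + ε.imK * (star y * x).imK = 0 := by
    rw [Quaternion.re_mul, hε] at hq
    linarith
  have hkey := smul_eq_of_orthogonal (v := (-2 : ℝ) • y) (q := star y * x) (d := ε) (m := m) hε
    (by simp [hm]; ring) (by simp; linarith) hq' (by simp [hm]; ring) (by simp [hm]; ring)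
    (by simp [hm]; ring)
  obtain ⟨c, hc⟩ : ∃ c : ℝ, ε = c • m := by
    refine ⟨(m.imI ^ 2 + m.imJ ^ 2 + m.imK ^ 2)⁻¹ *
      (ε.imI * m.imI + ε.imJ * m.imJ + ε.imK * m.imK), ?_⟩
    rw [mul_smul, ← hkey, inv_smul_smul₀ hnorm]
  refine ⟨c, mul_right_cancel₀ hy0 ?_, hc⟩
  have hn : (x * y).im * (x * y) = x * y * (x * y).im := (commute_im_iff.2 (Commute.refl _)).eq
  rw [eq_neg_of_add_eq_zero_right h, hc, mul_smul_comm, smul_mul_assoc, ← smul_neg]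
  congr 1
  rw [hm, mul_sub, sub_mul, ← mul_assoc x y, ← hn]
  simp only [mul_assoc]
  abel

/-- Paired with an element commuting with `p`, the `k` terms `p ^ i dp p ^ (k - 1 - i)` of the
Leibniz rule have the same real part, by cyclicity. The extra factor `p` on the left avoids the
exponent `k - 1`. -/
theorem re_fderiv_prod_pow_mul (X b : Fin 2 → ℍ[ℝ]) (k : ℕ) (w : ℍ[ℝ])
    (hw : Commute (X 0 * X 1) w) :
    (fderiv ℝ (fun Y : Fin 2 → ℍ[ℝ] => (Y 0 * Y 1) ^ k) X b * (X 0 * X 1 * w)).re =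
      k * ((X 0 * X 1) ^ k * fderiv ℝ (fun Y : Fin 2 → ℍ[ℝ] => Y 0 * Y 1) X b * w).re := by
  induction k generalizing w with
  | zero => simp
  | succ k ih =>
    simp only [pow_succ (_ * _) k]
    rw [fderiv_mul_apply (differentiableAt_prod_pow k X) (differentiableAt_prod X), add_mul,
      Quaternion.re_add, mul_assoc _ (X 0 * X 1) (X 0 * X 1 * w),
      ih (X 0 * X 1 * w) ((Commute.refl _).mul_right hw)]
    have h : ((X 0 * X 1) ^ k * (X 0 * X 1) *
        fderiv ℝ (fun Y : Fin 2 → ℍ[ℝ] => Y 0 * Y 1) X b * w).re =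
        ((X 0 * X 1) ^ k * fderiv ℝ (fun Y : Fin 2 → ℍ[ℝ] => Y 0 * Y 1) X b *
          (X 0 * X 1 * w)).re := by
      rw [← pow_succ, pow_succ', mul_assoc, mul_assoc, re_mul_comm, hw.eq]
      simp only [mul_assoc]
    rw [h]
    push_cast
    ring

/-- Differentiate `p ^ k p = p p ^ k`; the terms containing `dp` cancel because `p ^ k` is real at
`X`. -/
theorem commute_fderiv_prod_pow (X b : Fin 2 → ℍ[ℝ]) {k : ℕ} {r : ℝ}
    (h : (X 0 * X 1) ^ k = r) :
    Commute (X 0 * X 1) (fderiv ℝ (fun Y : Fin 2 → ℍ[ℝ] => (Y 0 * Y 1) ^ k) X b) := by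
  have e : (fun Y : Fin 2 → ℍ[ℝ] => (Y 0 * Y 1) ^ k * (Y 0 * Y 1)) =
      fun Y => (Y 0 * Y 1) * (Y 0 * Y 1) ^ k := by
    funext Y
    rw [← pow_succ, pow_succ']
  have h2 := congrArg (fun f => fderiv ℝ f X b) e
  simp only [fderiv_mul_apply (differentiableAt_prod_pow k X) (differentiableAt_prod X),
    fderiv_mul_apply (differentiableAt_prod X) (differentiableAt_prod_pow k X), h] at h2
  rw [add_comm, Quaternion.coe_commutes] at h2
  exact (add_right_cancel h2).symm

/-- If `q` commutes with `p`, then `|Im p|² Im q = (Im q · Im p) Im p`, and only `Im q` matters in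
`[q, x]`. -/
theorem normSq_smul_commutator {p q : ℍ[ℝ]} (h : Commute p q) (x : ℍ[ℝ]) :
    Quaternion.normSq p.im • (q * x - x * q) =
      (-(q * p.im).re) • (p.im * x - x * p.im) := by
  have hc := (commute_im_iff.2 h).eq
  have h1 := congrArg QuaternionAlgebra.imI hc
  have h2 := congrArg QuaternionAlgebra.imJ hc
  have h3 := congrArg QuaternionAlgebra.imK hc
  simp at h1 h2 h3
  ext
  · simp
    ring
  · simp [Quaternion.normSq_def']
    linear_combination (-x.imK * p.imK - x.imJ * p.imJ) * h1 + x.imJ * p.imI * h2 +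
      x.imK * p.imI * h3
  · simp [Quaternion.normSq_def']
    linear_combination x.imI * p.imJ * h1 + (-x.imI * p.imI - x.imK * p.imK) * h2 +
      x.imK * p.imJ * h3
  · simp [Quaternion.normSq_def']
    linear_combination x.imI * p.imK * h1 + x.imJ * p.imK * h2 +
      (-x.imJ * p.imJ - x.imI * p.imI) * h3

/-- The tangent space as a linear subspace. -/
def tangentSubmodule {N : ℕ} (X : Fin N → ℍ[ℝ]) : Submodule ℝ (Fin N → ℍ[ℝ]) where
  carrier := tangent X
  zero_mem' := fun i => by simp
  add_mem' := fun {a b} ha hb i => by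
    simp [inner_add_right, (ha i).1, (hb i).1, (ha i).2, (hb i).2]
  smul_mem' := fun c a ha i => by
    simp [inner_smul_right, (ha i).1, (ha i).2]

theorem re_mul_star_prod {X b : Fin 2 → ℍ[ℝ]} (hb : b ∈ tangent X) :
    ((X 0 * b 1 + b 0 * X 1) * star (X 0 * X 1)).re = 0 := by
  have h0 := (hb 0).2
  have h1 := (hb 1).2
  rw [inner_coords] at h0 h1
  simp
  linear_combination
    ((X 1).re ^ 2 + (X 1).imI ^ 2 + (X 1).imJ ^ 2 + (X 1).imK ^ 2) * h0 +
    ((X 0).re ^ 2 + (X 0).imI ^ 2 + (X 0).imJ ^ 2 + (X 0).imK ^ 2) * h1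

theorem re_mul_star_mul_im {p q : ℍ[ℝ]} (hp : ‖p‖ = 1) (hq : (q * star p).re = 0) :
    (q * (star p * p.im)).re = q.re := by
  have h := sum_sq_of_norm_eq_one hp
  simp at hq ⊢
  linear_combination q.re * h - p.re * hq

theorem exists_tangent_commutator {θ : Fin 2 → ℝ} {l : ℕ} (hl : 0 < l) {X : Fin 2 → ℍ[ℝ]}
    (hX : X ∈ irrRep θ) {r : ℝ} (hr : r ≠ 0) (h : (X 0 * X 1) ^ l = r) :
    ∃ b ∈ tangent X, ∃ c : ℝ, c ≠ 0 ∧ ∀ j,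
      fderiv ℝ (fun Y : Fin 2 → ℍ[ℝ] => (Y 0 * Y 1) ^ l) X b * X j -
        X j * fderiv ℝ (fun Y : Fin 2 → ℍ[ℝ] => (Y 0 * Y 1) ^ l) X b =
      c • ((X 0 * X 1).im * X j - X j * (X 0 * X 1).im) := by
  have hxy := isIrreducible_fin_two.1 hX.2
  have hp := norm_mul_of_mem_repSpace hX.1
  have hp0 : (X 0 * X 1).im ≠ 0 := by
    intro h0
    apply (not_commute_mul hxy).1
    rw [← commute_im_iff, h0]
    exact Commute.zero_left _
  set ξ := X 0 * X 1 - X 1 * X 0 with hξ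
  have hξ0 : ξ ≠ 0 := sub_ne_zero.2 hxy
  have hξre : ξ.re = 0 := by
    rw [hξ, Quaternion.re_sub, re_mul_comm, sub_self]
  -- Rotate `X 0` about the axis `ξ`, orthogonal to both imaginary parts, keeping `X 1` fixed. This
  -- changes the angle between them to first order: the real part of the product varies at the rate
  -- `-|ξ|²`.
  let b : Fin 2 → ℍ[ℝ] := ![ξ * X 0 - X 0 * ξ, 0]
  have hb : b ∈ tangent X := by
    intro i
    fin_cases i
    · constructor
      · change (ξ * X 0 - X 0 * ξ).re = 0
        rw [Quaternion.re_sub, re_mul_comm, sub_self]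
      · change inner ℝ (X 0) (ξ * X 0 - X 0 * ξ) = 0
        rw [inner_coords]
        simp
        ring
    · change (0 : ℍ[ℝ]).re = 0 ∧ inner ℝ (X 1) (0 : ℍ[ℝ]) = 0
      simp
  have hd : fderiv ℝ (fun Y : Fin 2 → ℍ[ℝ] => Y 0 * Y 1) X b =
      X 0 * b 1 + b 0 * X 1 := fderiv_prod_apply X b
  have hdre : (X 0 * b 1 + b 0 * X 1).re ≠ 0 := by
    have h1 : (X 0 * b 1 + b 0 * X 1).re = -Quaternion.normSq ξ := by
      change (X 0 * 0 + (ξ * X 0 - X 0 * ξ) * X 1).re = _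
      have h2 : (X 0 * ξ * X 1).re = (ξ * (X 1 * X 0)).re := by
        rw [mul_assoc, re_mul_comm, mul_assoc]
      rw [mul_zero, zero_add, sub_mul, Quaternion.re_sub, h2, mul_assoc, ← Quaternion.re_sub,
        ← mul_sub, ← hξ, Quaternion.normSq_def', Quaternion.re_mul, hξre]
      ring
    rw [h1]
    exact neg_ne_zero.2 (Quaternion.normSq_ne_zero.2 hξ0)
  set F := fderiv ℝ (fun Y : Fin 2 → ℍ[ℝ] => (Y 0 * Y 1) ^ l) X b with hF
  have hcs : Commute (X 0 * X 1) (star (X 0 * X 1)) := by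
    rw [Commute, SemiconjBy, Quaternion.self_mul_star, Quaternion.star_mul_self]
  have hre : (F * (X 0 * X 1).im).re = l * r * (X 0 * b 1 + b 0 * X 1).re := by
    have h1 := re_fderiv_prod_pow_mul X b l (star (X 0 * X 1) * (X 0 * X 1).im)
      (hcs.mul_right (commute_im_iff.2 (Commute.refl _)).symm)
    rw [← hF, ← mul_assoc (X 0 * X 1), Quaternion.self_mul_star,
      Quaternion.normSq_eq_norm_mul_self, hp, mul_one, Quaternion.coe_one, one_mul, h, hd,
      mul_assoc, Quaternion.coe_mul_eq_smul, Quaternion.re_smul,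
      re_mul_star_mul_im hp (re_mul_star_prod hb)] at h1
    rw [h1, smul_eq_mul, mul_assoc]
  have hN : Quaternion.normSq (X 0 * X 1).im ≠ 0 := Quaternion.normSq_ne_zero.2 hp0
  refine ⟨b, hb, (Quaternion.normSq (X 0 * X 1).im)⁻¹ * -(F * (X 0 * X 1).im).re, ?_, fun j => ?_⟩
  · rw [hre]
    have : (l : ℝ) ≠ 0 := by positivity
    exact mul_ne_zero (inv_ne_zero hN) (neg_ne_zero.2 (mul_ne_zero (mul_ne_zero this hr) hdre))
  · rw [mul_smul, ← normSq_smul_commutator (commute_fderiv_prod_pow X b h), inv_smul_smul₀ hN]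

theorem exists_pow_eq_coe {θ : Fin 2 → ℝ} {l : ℕ} {X : Fin 2 → ℍ[ℝ]}
    (hX : X ∈ meets θ (graphMap (torusBraid l : BraidGroup 2))) :
    ∃ r : ℝ, r ≠ 0 ∧ (X 0 * X 1) ^ l = r := by
  have hne := repSpace_ne_zero hX.1.1
  obtain ⟨-, h⟩ := sin_eq_zero_of_commute (norm_mul_of_mem_repSpace hX.1.1)
    (commute_pow_of_mem_meets hX 0) (not_commute_mul (isIrreducible_fin_two.1 hX.1.2)).1
  refine ⟨_, fun h0 => ?_, h⟩
  rw [h0, Quaternion.coe_zero] at h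
  exact pow_ne_zero l (mul_ne_zero (hne 0) (hne 1)) h

theorem isTransverse_torusBraid {l : ℕ} (hl : 0 < l) (θ : Fin 2 → ℝ) :
    IsTransverse θ (graphMap (torusBraid l : BraidGroup 2)) := by
  intro X hX Z hZ τ hτ hdef
  obtain ⟨r, hr, hrX⟩ := exists_pow_eq_coe ⟨hX, Z, hZ⟩
  obtain rfl := (graphMap_eq_diag.1 hZ).1
  have hne := repSpace_ne_zero hX.1
  have h := fderiv_defect_diag hne hdef
  obtain ⟨b, hb, c, hc, hbc⟩ := exists_tangent_commutator hl hX hr hrX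
  obtain ⟨d, hd0, hd1⟩ := exists_eq_smul_commutator (x := Z 0) (y := Z 1) (δ := τ 2 - τ 0)
    (ε := τ 3 - τ 1) (isIrreducible_fin_two.1 hX.2)
    (by rw [Quaternion.re_sub, (hτ 2).1, (hτ 0).1, sub_self])
    (by rw [Quaternion.re_sub, (hτ 3).1, (hτ 1).1, sub_self])
    (by
      have h3 : inner ℝ (Z 1) (τ 3) = 0 := (hτ 3).2
      have h1 : inner ℝ (Z 1) (τ 1) = 0 := (hτ 1).2
      rw [inner_sub_right, h3, h1, sub_self])
    (by rw [mul_sub, sub_mul, sub_add_sub_comm, h, sub_self])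
  have hd (j : Fin 2) : τ (Fin.natAdd 2 j) - τ (Fin.castAdd 2 j) =
      d • ((Z 0 * Z 1).im * Z j - Z j * (Z 0 * Z 1).im) := by
    fin_cases j
    · exact hd0
    · exact hd1
  have hτ1 : (fun j => τ (Fin.castAdd 2 j)) ∈ tangent Z := fun j => by
    simpa only [diag, Fin.append_left] using hτ (Fin.castAdd 2 j)
  -- The scalar is chosen so that the graph's commutator term, `r⁻¹ c` times the basic one, becomes
  -- the required multiple `d`.
  have hsb : (d * r / c) • b ∈ tangentSubmodule Z := Submodule.smul_mem _ _ hb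
  refine ⟨(fun j => τ (Fin.castAdd 2 j)) - (d * r / c) • b,
    Submodule.sub_mem (tangentSubmodule Z) hτ1 hsb, (d * r / c) • b, hsb, ?_⟩
  rw [map_smul, fderiv_graphMap_torusBraid hne hr hrX]
  funext k
  refine Fin.addCases (fun j => ?_) (fun j => ?_) k
  · simp only [diag, Pi.add_apply, Pi.sub_apply, Pi.smul_apply, Fin.append_left]
    abel
  · simp only [diag, Pi.add_apply, Pi.sub_apply, Pi.smul_apply, Fin.append_right]
    rw [hbc, smul_add, smul_smul, smul_smul, show d * r / c * r⁻¹ * c = d by field_simp, ← hd j]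
    abel

/-- A decomposition for `l` gives one for `-l`: the derivative of the first graph at `b` is that of
the second at `-b`, plus `2 (b, b)`, which the diagonal absorbs. -/
theorem isTransverse_torusBraid_neg {l : ℕ} (hl : 0 < l) (θ : Fin 2 → ℝ) :
    IsTransverse θ (graphMap (torusBraid (-l) : BraidGroup 2)) := by
  intro X hX Z hZ τ hτ hdef
  have hm : X ∈ meets θ (graphMap (torusBraid l : BraidGroup 2)) := by
    rw [← meets_torusBraid_neg]
    exact ⟨hX, Z, hZ⟩
  obtain ⟨r, hr, hrX⟩ := exists_pow_eq_coe hm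
  obtain rfl := (graphMap_eq_diag.1 hZ).1
  obtain ⟨a, ha, b, hb, hab⟩ := isTransverse_torusBraid hl θ Z hX Z
    (graphMap_eq_diag.2 ⟨rfl, (mem_meets_graphMap.1 hm).2⟩) τ hτ hdef
  refine ⟨a + (2 : ℝ) • b, Submodule.add_mem (tangentSubmodule Z) ha
    (Submodule.smul_mem _ _ hb), -b, Submodule.neg_mem (tangentSubmodule Z) hb, ?_⟩
  rw [hab, map_neg, diag_add, diag_smul,
    ← fderiv_graphMap_torusBraid_add (repSpace_ne_zero hX.1) hr hrX]
  abel

/-! ## Local signs -/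

theorem IsPositivePair.exists_eq_add {x u v t : ℍ[ℝ]} (h : IsPositivePair x u v) (ht : t.re = 0)
    (hxt : inner ℝ x t = 0) : ∃ c d : ℝ, t = c • u + d • v := by
  obtain ⟨hu, hv, hxu, hxv, hT⟩ := h
  rw [inner_coords] at hxu hxv hxt
  have hTe : triple x u v = x.imI * (u.imJ * v.imK - u.imK * v.imJ) -
      x.imJ * (u.imI * v.imK - u.imK * v.imI) + x.imK * (u.imI * v.imJ - u.imJ * v.imI) := by
    simp [triple, Matrix.det_fin_three]
    ring
  set T := triple x u v with hTd
  set D := t.imI * (u.imJ * v.imK - u.imK * v.imJ) -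
      t.imJ * (u.imI * v.imK - u.imK * v.imI) + t.imK * (u.imI * v.imJ - u.imJ * v.imI) with hD
  have hx : 0 < x.imI ^ 2 + x.imJ ^ 2 + x.imK ^ 2 := by
    by_contra hle
    have h1 : x.imI = 0 := by nlinarith [sq_nonneg x.imI, sq_nonneg x.imJ, sq_nonneg x.imK]
    have h2 : x.imJ = 0 := by nlinarith [sq_nonneg x.imI, sq_nonneg x.imJ, sq_nonneg x.imK]
    have h3 : x.imK = 0 := by nlinarith [sq_nonneg x.imI, sq_nonneg x.imJ, sq_nonneg x.imK]
    rw [hTe, h1, h2, h3] at hT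
    simp at hT
  have hT' := hT.ne'
  rw [hu] at hxu
  rw [hv] at hxv
  rw [ht] at hxt
  -- The vectors `t`, `u`, `v` all lie in the plane orthogonal to `Im x`, so they are dependent; the
  -- coefficients of `t` below come from Cramer's rule in the basis `x, u, v`.
  have hD0 : D = 0 := by
    have : D * (x.imI ^ 2 + x.imJ ^ 2 + x.imK ^ 2) = 0 := by
      rw [hD]
      linear_combination (x.imI * (u.imJ * v.imK - u.imK * v.imJ) -
        x.imJ * (u.imI * v.imK - u.imK * v.imI) + x.imK * (u.imI * v.imJ - u.imJ * v.imI)) * hxt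
        - (x.imI * (t.imJ * v.imK - t.imK * v.imJ) -
        x.imJ * (t.imI * v.imK - t.imK * v.imI) + x.imK * (t.imI * v.imJ - t.imJ * v.imI)) * hxu
        - (x.imI * (u.imJ * t.imK - u.imK * t.imJ) -
        x.imJ * (u.imI * t.imK - u.imK * t.imI) + x.imK * (u.imI * t.imJ - u.imJ * t.imI)) * hxv
    exact (mul_eq_zero.1 this).resolve_right hx.ne'
  refine ⟨(x.imI * (t.imJ * v.imK - t.imK * v.imJ) -
        x.imJ * (t.imI * v.imK - t.imK * v.imI) + x.imK * (t.imI * v.imJ - t.imJ * v.imI)) / T,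
      (x.imI * (u.imJ * t.imK - u.imK * t.imJ) -
        x.imJ * (u.imI * t.imK - u.imK * t.imI) + x.imK * (u.imI * t.imJ - u.imJ * t.imI)) / T,
      ?_⟩
  ext
  · simp [ht, hu, hv]
  · simp
    field_simp
    rw [hTe]
    linear_combination x.imI * hD0
  · simp
    field_simp
    rw [hTe]
    linear_combination x.imJ * hD0
  · simp
    field_simp
    rw [hTe]
    linear_combination x.imK * hD0

theorem productFrame_mem_tangent {N : ℕ} {X u v : Fin N → ℍ[ℝ]}
    (h : ∀ i, IsPositivePair (X i) (u i) (v i)) (p : Fin N × Fin 2) :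
    productFrame u v p ∈ tangent X := by
  intro i
  obtain ⟨hu, hv, hxu, hxv, -⟩ := h i
  rcases eq_or_ne i p.1 with rfl | hi
  · rw [productFrame, Pi.single_eq_same]
    split_ifs
    exacts [⟨hu, hxu⟩, ⟨hv, hxv⟩]
  · rw [productFrame, Pi.single_eq_of_ne hi]
    simp

theorem IsFrame.mem_tangent {N : ℕ} {X : Fin N → ℍ[ℝ]} {e : Fin (N * 2) → Fin N → ℍ[ℝ]} {s : ℤ}
    (h : IsFrame X e s) (k : Fin (N * 2)) : e k ∈ tangent X := by
  obtain ⟨u, v, huv, A, -, hA⟩ := h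
  rw [← finProdFinEquiv.apply_symm_apply k, hA]
  exact Submodule.sum_mem (tangentSubmodule X) fun q _ =>
    Submodule.smul_mem _ _ (productFrame_mem_tangent huv q)

theorem IsFrame.exists_eq_sum {N : ℕ} {X : Fin N → ℍ[ℝ]} {e : Fin (N * 2) → Fin N → ℍ[ℝ]} {s : ℤ}
    (h : IsFrame X e s) {t : Fin N → ℍ[ℝ]} (ht : t ∈ tangent X) :
    ∃ c : Fin (N * 2) → ℝ, t = ∑ k, c k • e k := by
  obtain ⟨u, v, huv, A, hdet, hA⟩ := h
  choose f g hfg using fun i => (huv i).exists_eq_add (ht i).1 (ht i).2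
  set d : Fin N × Fin 2 → ℝ := fun p => if p.2 = 0 then f p.1 else g p.1 with hd
  have hsum : t = ∑ q, d q • productFrame u v q := by
    rw [Fintype.sum_prod_type]
    funext i
    rw [Finset.sum_apply, Finset.sum_eq_single i]
    · simp [hd, productFrame, Fin.sum_univ_two, hfg i]
    · intro j _ hj
      simp [productFrame, hj.symm]
    · simp
  have hunit : IsUnit A.det := by
    rw [isUnit_iff_ne_zero]
    rintro h0
    simp [h0] at hdet
  refine ⟨fun k => Matrix.vecMul d A⁻¹ (finProdFinEquiv.symm k), ?_⟩
  rw [← finProdFinEquiv.sum_comp]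
  simp only [Equiv.symm_apply_apply, hA, Finset.smul_sum, smul_smul]
  rw [Finset.sum_comm]
  simp only [← Finset.sum_smul]
  have hv : Matrix.vecMul (Matrix.vecMul d A⁻¹) A = d := by
    rw [Matrix.vecMul_vecMul, Matrix.nonsing_inv_mul _ hunit, Matrix.vecMul_one]
  nth_rewrite 1 [hsum]
  refine Finset.sum_congr rfl fun q _ => ?_
  congr 1
  exact (congrFun hv q).symm

/-- Replacing a row by a combination of all rows multiplies the determinant by the coefficient of
that row itself, here `-1`. -/
theorem IsFrame.neg_of_update {N : ℕ} {X : Fin N → ℍ[ℝ]} {e e' : Fin (N * 2) → Fin N → ℍ[ℝ]}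
    {s : ℤ} (h : IsFrame X e s) (k₀ : Fin (N * 2)) (c : Fin (N * 2) → ℝ) (hc : c k₀ = -1)
    (he : ∀ k, k ≠ k₀ → e' k = e k) (he₀ : e' k₀ = ∑ k, c k • e k) : IsFrame X e' (-s) := by
  obtain ⟨u, v, huv, A, hdet, hA⟩ := h
  obtain ⟨p₀, rfl⟩ := finProdFinEquiv.surjective k₀
  refine ⟨u, v, huv, A.updateRow p₀ (∑ p, c (finProdFinEquiv p) • A p), ?_, fun p => ?_⟩
  · rw [Matrix.det_updateRow_sum A p₀ fun p => c (finProdFinEquiv p), hc]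
    push_cast
    simpa using hdet
  · rcases eq_or_ne p p₀ with rfl | hp
    · rw [he₀, ← finProdFinEquiv.sum_comp]
      simp only [hA, Finset.smul_sum, smul_smul, Matrix.updateRow_self, Finset.sum_apply,
        Pi.smul_apply, smul_eq_mul, Finset.sum_smul]
      exact Finset.sum_comm
    · rw [he _ fun hk => hp (finProdFinEquiv.injective hk), hA]
      simp only [Matrix.updateRow_ne hp]

theorem diag_orbitFrame {n : ℕ} (Z : Fin n → ℍ[ℝ]) (k : Fin 3) :
    diag (orbitFrame Z k) = orbitFrame (diag Z) k := by
  funext i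
  refine Fin.addCases (fun i => ?_) (fun j => ?_) i <;>
    simp only [diag, orbitFrame, Fin.append_left, Fin.append_right]

/-- The frame contains a single vector coming from the graph. Passing from `G₁` to `G₂` negates it
up to `2 (b, b)`, and `b` is a combination of `a` and the orbit directions, whose diagonal images
already belong to the frame. -/
theorem HasSign.neg {G₁ G₂ : (Fin 2 → ℍ[ℝ]) → Fin (2 + 2) → ℍ[ℝ]} {X : Fin 2 → ℍ[ℝ]} {s : ℤ}
    (hG : ∀ b, fderiv ℝ G₁ X b + fderiv ℝ G₂ X b = (2 : ℝ) • diag b)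
    (h : HasSign G₁ X X s) : HasSign G₂ X X (-s) := by
  obtain ⟨m, hm, w, a, b, ha, hb, hw, he⟩ := h
  obtain rfl : m = 1 := by omega
  refine ⟨1, hm, w, a, b, ha, hb, hw, ?_⟩
  have hbt : b 0 ∈ tangent X := hb.mem_tangent 0
  obtain ⟨c, hc⟩ := ha.exists_eq_sum hbt
  have hc' : b 0 = c 0 • a 0 + c 1 • orbitFrame X 0 + c 2 • orbitFrame X 1 +
      c 3 • orbitFrame X 2 := hc.trans (Fin.sum_univ_four _)
  -- The eight frame vectors are three lifts `w`, then `diag (a 0)`, then the graph vector at index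
  -- `4`, then three orbit directions.
  refine he.neg_of_update 4 ![0, 0, 0, 2 * c 0, -1, 2 * c 1, 2 * c 2, 2 * c 3] rfl ?_ ?_
  · intro k hk
    change Fin 8 at k
    fin_cases k <;> first | rfl | exact absurd rfl hk
  · refine Eq.trans ?_ (Fin.sum_univ_eight _).symm
    change fderiv ℝ G₂ X (b 0) = (0 : ℝ) • w 0 + (0 : ℝ) • w 1 + (0 : ℝ) • w 2 +
      (2 * c 0) • diag (a 0) + (-1 : ℝ) • fderiv ℝ G₁ X (b 0) +
      (2 * c 1) • orbitFrame (diag X) 0 + (2 * c 2) • orbitFrame (diag X) 1 +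
      (2 * c 3) • orbitFrame (diag X) 2
    rw [← add_right_inj (fderiv ℝ G₁ X (b 0)), hG]
    nth_rewrite 1 [hc']
    simp only [diag_add, diag_smul, diag_orbitFrame, smul_add, smul_smul, zero_smul, neg_smul,
      one_smul]
    abel

theorem localSign_eq_neg {n : ℕ} {G₁ G₂ : (Fin n → ℍ[ℝ]) → Fin (n + n) → ℍ[ℝ]}
    {X : Fin n → ℍ[ℝ]}
    (h : ∀ s, (∃ Z, G₂ X = diag Z ∧ HasSign G₂ X Z s) ↔
      ∃ Z, G₁ X = diag Z ∧ HasSign G₁ X Z (-s)) :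
    localSign G₂ X = -localSign G₁ X := by
  rw [localSign, localSign, propext (h 1), propext (h (-1)), neg_neg, neg_sub]

theorem localSign_neg {l : ℕ} {θ : Fin 2 → ℝ} {X : Fin 2 → ℍ[ℝ]}
    (hX : X ∈ meets θ (graphMap (torusBraid l : BraidGroup 2))) :
    localSign (graphMap (torusBraid (-l) : BraidGroup 2)) X =
      -localSign (graphMap (torusBraid l : BraidGroup 2)) X := by
  obtain ⟨r, hr, hrX⟩ := exists_pow_eq_coe hX
  have hne := repSpace_ne_zero hX.1.1
  have hfix := (mem_meets_graphMap.1 hX).2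
  have hadd := fderiv_graphMap_torusBraid_add hne hr hrX
  have hdiag (k : ℤ) (hk : tupleAct X (torusBraid k : BraidGroup 2) = X) (s : ℤ) :
      (∃ Z, graphMap (torusBraid k : BraidGroup 2) X = diag Z ∧
        HasSign (graphMap (torusBraid k : BraidGroup 2)) X Z s) ↔
      HasSign (graphMap (torusBraid k : BraidGroup 2)) X X s := by
    refine ⟨?_, fun h => ⟨X, graphMap_eq_diag.2 ⟨rfl, hk⟩, h⟩⟩
    rintro ⟨Z, hZ, h⟩
    obtain rfl := (graphMap_eq_diag.1 hZ).1
    exact h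
  refine localSign_eq_neg fun s => (hdiag _ ((tupleAct_torusBraid_neg_eq_self hne).2 hfix) s).trans
    (Iff.trans ⟨HasSign.neg fun b => (add_comm _ _).trans (hadd b), fun h => ?_⟩
      (hdiag _ hfix (-s)).symm)
  have := h.neg hadd
  rwa [neg_neg] at this

theorem signedCount_neg (θ : Fin 2 → ℝ) (l : ℕ) :
    signedCount θ (graphMap (torusBraid (-l) : BraidGroup 2)) =
      -signedCount θ (graphMap (torusBraid l : BraidGroup 2)) := by
  -- As the two intersection sets are equal, both sums use the same representatives `q.out`, so
  -- invariance of `localSign` under conjugation is not required.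
  have key (S T : Set (Fin 2 → ℍ[ℝ])) (hST : S = T) (f g : (Fin 2 → ℍ[ℝ]) → ℤ)
      (hfg : ∀ X ∈ T, f X = -g X) :
      ∑ᶠ q : Quotient (conjSetoid S), f (q.out : Fin 2 → ℍ[ℝ]) =
        -∑ᶠ q : Quotient (conjSetoid T), g (q.out : Fin 2 → ℍ[ℝ]) := by
    subst hST
    rw [← finsum_neg_distrib]
    exact finsum_congr fun q => hfg _ q.out.2
  exact key _ _ (meets_torusBraid_neg θ l) _ _ fun X hX => localSign_neg hX

/-! ## The invariants of torus links -/

theorem IsTransverse.isIntersectionNumber_iff {n : ℕ} {θ : Fin n → ℝ} {β : BraidGroup n}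
    (h : IsTransverse θ (graphMap β)) {k : ℤ} :
    IsIntersectionNumber θ β k ↔ k = signedCount θ (graphMap β) := by
  simp [IsIntersectionNumber, h]

/-- Transversality excludes the perturbed branch of `IsIntersectionNumber`, so uniqueness does not
depend on invariance under perturbation. -/
theorem isBenardConway_iff {n μ : ℕ} {c : Fin n → Fin μ} {β : coloredBraidGroup c} {α : Fin μ → ℝ}
    (hA : AlexanderNonvanishing c β α)
    (hK : IsCompact (meets (fun i => α (c i)) (graphMap (β : BraidGroup n))))
    (hT : IsTransverse (fun i => α (c i)) (graphMap (β : BraidGroup n))) {k : ℤ} :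
    IsBenardConway β α k ↔ k = signedCount (fun i => α (c i)) (graphMap (β : BraidGroup n)) :=
  ⟨fun h => hT.isIntersectionNumber_iff.1 h.intersection, fun h =>
    ⟨hA, compactSpace_intersectionPoints hK, hT.isIntersectionNumber_iff.2 h⟩⟩

theorem benardConway_eq {n μ : ℕ} {c : Fin n → Fin μ} {β : coloredBraidGroup c} {α : Fin μ → ℝ}
    {k : ℤ} (h : ∀ j, IsBenardConway β α j ↔ j = k) : benardConway β α = k := by
  have hex : ∃ j, IsBenardConway β α j := ⟨k, (h k).2 rfl⟩
  rw [benardConway, dif_pos hex]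
  exact (h _).1 hex.choose_spec

end BenardConway

end

theorem corollary5p7 (l : ℤ) (hl : 0 < l) (α : Fin 2 → ℝ)
    (hα : ∀ i, 0 < α i ∧ α i < Real.pi) (hroot : α ∉ BenardConway.rootSet l) :
    BenardConway.BenardConwayWellDefined (BenardConway.torusBraid l) α ∧
    BenardConway.BenardConwayWellDefined (BenardConway.torusBraid (-l)) α ∧
    BenardConway.benardConway (BenardConway.torusBraid (-l)) α =
      -BenardConway.benardConway (BenardConway.torusBraid l) α := by
  open BenardConway in
  lift l to ℕ using hl.le
  have hl' : 0 < l := by exact_mod_cast hl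
  have hK := isCompact_meets_torusBraid hl' (fun i : Fin 2 => α (id i))
  have h₁ (k : ℤ) := isBenardConway_iff (k := k) (β := torusBraid l)
    (alexanderNonvanishing_torusBraid hl' hα hroot (isAlexanderPolynomial_torusBraid_natCast l))
    hK (isTransverse_torusBraid hl' _)
  have h₂ (k : ℤ) := isBenardConway_iff (k := k) (β := torusBraid (-l))
    (alexanderNonvanishing_torusBraid hl' hα hroot (isAlexanderPolynomial_torusBraid_neg l))
    (by rw [meets_torusBraid_neg]; exact hK) (isTransverse_torusBraid_neg hl' _)
  refine ⟨⟨_, (h₁ _).2 rfl, fun k hk => (h₁ k).1 hk⟩, ⟨_, (h₂ _).2 rfl, fun k hk => (h₂ k).1 hk⟩, ?_⟩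
  rw [benardConway_eq h₁, benardConway_eq h₂]
  exact signedCount_neg _ l
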